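/- There is an absolute constant $C>0$ with the following property. Let $(\Omega,\mathcal P)$ be a probability space carrying independent Rademacher random variables $\xi_k\colon\Omega\to\{\pm1\}$, $k\in\mathbb Z$ (each value is taken with probability $\tfrac12$). Let $\mathbb T=\mathbb R/\mathbb Z$ with normalized Lebesgue measure $m$, let $Q=\Omega\times\mathbb T$ with $\mu=\mathcal P\times m$, and let $f\in L^2(Q,\mu)$ be a Rademacher Fourier series, that is, an element of the closed complex linear span in $L^2(Q,\mu)$ of the functions $(\omega,\theta)\mapsto\xi_k(\omega)e^{2\pi ik\theta}$, $k\in\mathbb Z$. Suppose $\|f\|_{L^2(\mu)}=1$. Then for every complex-valued $b\in L^\infty(\Omega)$ with $\|b\|_\infty<\tfrac1{20}$ and every real $p\ge1$, \[ \int_Q\bigl|\log|f(\omega,\theta)-b(\omega)|\bigr|^p\,d\mu(\omega,\theta)\le (Cp)^{6p}, \] where $|\log 0|=+\infty$. In particular (taking $b=0$), $f\ne0$ $\mu$-almost everywhere, and $\bigl|\log|f|\bigr|^p$ for every real $p>0$ and $(\log|f|)^n$ for every integer $n\ge0$ are $\mu$-integrable on $Q$. -/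

import Mathlib

open MeasureTheory ProbabilityTheory
open scoped ENNReal

/-- `ξ k`, `k ∈ ℤ`, are independent Rademacher random variables on `(Ω, P)`: each takes the
values `1` and `-1`, with probability `1/2` each. -/
structure IsRademacherSeq {Ω : Type*} [MeasurableSpace Ω] (P : Measure Ω)
    (ξ : ℤ → Ω → ℝ) : Prop where
  measurable : ∀ k, Measurable (ξ k)
  eq_one_or : ∀ k ω, ξ k ω = 1 ∨ ξ k ω = -1
  prob_one : ∀ k, P {ω | ξ k ω = 1} = 1 / 2
  prob_neg_one : ∀ k, P {ω | ξ k ω = -1} = 1 / 2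
  indep : iIndepFun ξ P

/-- The product measure `μ = P × m` on `Q = Ω × 𝕋`, where `𝕋 = ℝ / ℤ` and `m` is the Lebesgue
measure on `𝕋` (of total mass `1`). -/
noncomputable def measureQ {Ω : Type*} [MeasurableSpace Ω] (P : Measure Ω) :
    Measure (Ω × UnitAddCircle) :=
  P.prod volume

instance measureQ_isProbabilityMeasure {Ω : Type*} [MeasurableSpace Ω] (P : Measure Ω)
    [IsProbabilityMeasure P] : IsProbabilityMeasure (measureQ P) := by
  have : IsProbabilityMeasure (volume : Measure UnitAddCircle) :=
    ⟨by simp [AddCircle.measure_univ]⟩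
  unfold measureQ
  infer_instance

/-- The function `φ_k(ω, θ) = ξ_k(ω) e^{2πikθ}` on `Q`. -/
noncomputable def radChar {Ω : Type*} (ξ : ℤ → Ω → ℝ) (k : ℤ) : Ω × UnitAddCircle → ℂ :=
  fun q => (ξ k q.1 : ℂ) * fourier k q.2

theorem memLp_radChar {Ω : Type*} [MeasurableSpace Ω] {P : Measure Ω} [IsProbabilityMeasure P]
    {ξ : ℤ → Ω → ℝ} (hξ : IsRademacherSeq P ξ) (k : ℤ) :
    MemLp (radChar ξ k) 2 (measureQ P) := by
  refine MemLp.of_bound (C := 1) ?_ (Filter.Eventually.of_forall fun q => ?_)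
  · refine Measurable.aestronglyMeasurable ?_
    have h1 : Measurable fun q : Ω × UnitAddCircle => ((ξ k q.1 : ℝ) : ℂ) :=
      Complex.measurable_ofReal.comp ((hξ.measurable k).comp measurable_fst)
    exact h1.mul ((fourier k).continuous.measurable.comp measurable_snd)
  · rcases hξ.eq_one_or k q.1 with h | h <;> simp [radChar, h, fourier_apply, Circle.norm_coe]

/-- The space of Rademacher Fourier series: the closed linear span in `L²(Q, μ)` of the
functions `ξ_k(ω) e^{2πikθ}`, `k ∈ ℤ`. -/
noncomputable def rademacherFourierSeries {Ω : Type*} [MeasurableSpace Ω] {P : Measure Ω}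
    [IsProbabilityMeasure P] {ξ : ℤ → Ω → ℝ} (hξ : IsRademacherSeq P ξ) :
    Submodule ℂ (Lp ℂ 2 (measureQ P)) :=
  (Submodule.span ℂ (Set.range fun k : ℤ => (memLp_radChar hξ k).toLp)).topologicalClosure

/-!
The moment bound follows from a small ball estimate: `‖f - b‖ < (1 / 2) ^ (801 n ^ 2)` with
probability at most `2 ^ (1 - n)`, for every `n`. Summed over `n`, it bounds the integral of a
function `logMajorant` that dominates `|log|f - b|| ^ p` up to a factor `(C p ^ 2) ^ p`; large
values of `f - b` only need its `L²` norm. By density it is enough to treat finite sums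
`∑ a_k ξ_k(ω) e^{2πikθ}` with `∑ |a_k| ^ 2` close to `1`.

*Centre `b = 0`.* Fix a threshold `δ'` larger than the radius `δ` by a factor
`2 ^ (C n ^ 2)`.
* If at least `n` coefficients exceed `δ'`, fix `n` of them. For two different sign patterns on
  these frequencies, the difference of the signed sums is an exponential sum with at most `n` terms
  and a coefficient of size at least `2 δ'`, so by a Turán type lemma
  (`volume_norm_trigSum_lt_le_pow`) it is at least `2 δ` for most `θ`, and a union bound over all
  pairs of patterns is affordable. For such `θ`, given the other signs, at most one of the `2 ^ n`
  patterns puts `f` in the ball (`IsRademacherSeq.measure_norm_sum_lt_le`).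
* If fewer than `n` coefficients exceed `δ'` and the others have tiny total variance, the Turán type
  lemma applies to the main part and Chebyshev's inequality to the rest.
* Otherwise the small coefficients have a variance that is large compared to `δ'`, and a Fourier
  analytic small ball estimate applies for every `θ` (`IsRademacherSeq.measure_abs_sum_le_le`).

*General centre.* If `|f - b| < δ` on a set `E`, then for every translation `t` of the circle,
`|f(ω, θ + t) - f(ω, θ)| < 2 δ` on the intersection of `E` with its translate. The average measure
of this intersection is at least the square of the measure of `E`, and the difference is again a
Rademacher Fourier series, to which the case `b = 0` applies for most `t`. The bound on `b` is only
used when the constant term `a_0 ξ_0` dominates.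

*The Turán type lemma.* All frequencies but one are removed successively, each time the lowest or
the highest one, by an operation of the form `p ↦ p' / (2πi) - l p`. This rarely increases `|p|` by
much more than the factor given by the spread of the frequencies, because the logarithmic derivative
of a polynomial of degree `d` on the unit circle is rarely much larger than `d`. The latter is
Kolmogorov's weak type inequality for a sum of functions `1 / (1 - c w)`, all of positive real part.
-/

/-! ### Kolmogorov's inequality for sums of simple fractions -/

instance isProbabilityMeasure_volume_unitAddCircle :
    IsProbabilityMeasure (volume : Measure UnitAddCircle) :=
  ⟨by simp [AddCircle.measure_univ]⟩

theorem re_inv_one_sub_pos {w : ℂ} (hw : ‖w‖ < 1) : 0 < ((1 - w)⁻¹).re := by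
  have h1 : 0 < (1 - w).re := by
    have := (Complex.abs_re_le_norm w)
    have := le_abs_self w.re
    simp only [Complex.sub_re, Complex.one_re]; linarith
  rw [Complex.inv_re]
  refine div_pos h1 (Complex.normSq_pos.2 ?_)
  intro h; simp [h] at h1

theorem norm_mul_lt_one {c w : ℂ} (hc : ‖c‖ ≤ 1) (hw : ‖w‖ < 1) : ‖c * w‖ < 1 := by
  rw [norm_mul]
  exact lt_of_le_of_lt (mul_le_of_le_one_left (norm_nonneg _) hc) hw

/-- The kernel sum `∑ 1 / (1 - c w)` over a multiset of parameters `c`. For parameters in the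
closed unit disc it is holomorphic with positive real part in the open unit disc. -/
noncomputable def invSum (s : Multiset ℂ) (w : ℂ) : ℂ := (s.map fun c => (1 - c * w)⁻¹).sum

@[simp] theorem invSum_cons (a : ℂ) (s : Multiset ℂ) (w : ℂ) :
    invSum (a ::ₘ s) w = (1 - a * w)⁻¹ + invSum s w := by simp [invSum]

@[simp] theorem invSum_nil (w : ℂ) : invSum 0 w = 0 := by simp [invSum]

theorem invSum_zero (s : Multiset ℂ) : invSum s 0 = s.card := by simp [invSum]

theorem re_invSum_nonneg {s : Multiset ℂ} (hs : ∀ c ∈ s, ‖c‖ ≤ 1) {w : ℂ} (hw : ‖w‖ < 1) :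
    0 ≤ (invSum s w).re := by
  induction s using Multiset.induction_on with
  | empty => simp
  | cons a s ih =>
    rw [invSum_cons, Complex.add_re]
    have h1 := re_inv_one_sub_pos (norm_mul_lt_one (hs a (by simp)) hw)
    have h2 := ih fun c hc => hs c (by simp [hc])
    linarith

theorem re_invSum_pos {s : Multiset ℂ} (h0 : s ≠ 0) (hs : ∀ c ∈ s, ‖c‖ ≤ 1) {w : ℂ}
    (hw : ‖w‖ < 1) : 0 < (invSum s w).re := by
  obtain ⟨a, ha⟩ := Multiset.exists_mem_of_ne_zero h0
  obtain ⟨s, rfl⟩ := Multiset.exists_cons_of_mem ha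
  rw [invSum_cons, Complex.add_re]
  have h1 := re_inv_one_sub_pos (norm_mul_lt_one (hs a (by simp)) hw)
  have h2 := re_invSum_nonneg (s := s) (fun c hc => hs c (by simp [hc])) hw
  linarith

theorem differentiableAt_invSum {s : Multiset ℂ} {w : ℂ} (hs : ∀ c ∈ s, c * w ≠ 1) :
    DifferentiableAt ℂ (invSum s) w := by
  induction s using Multiset.induction_on with
  | empty =>
    have : invSum 0 = fun _ => 0 := by ext; simp
    rw [this]; fun_prop
  | cons a s ih =>
    have : invSum (a ::ₘ s) = fun w => (1 - a * w)⁻¹ + invSum s w := by ext; simp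
    rw [this]
    have h1 : 1 - a * w ≠ 0 := sub_ne_zero.2 (hs a (by simp)).symm
    have h2 := ih fun c hc => hs c (by simp [hc])
    have h3 : DifferentiableAt ℂ (fun w => (1 - a * w)⁻¹) w :=
      DifferentiableAt.inv (by fun_prop) h1
    exact h3.add h2

theorem sqrt_norm_le_re_cpow {z : ℂ} (hz : 0 < z.re) :
    √‖z‖ ≤ √2 * (z ^ ((2 : ℕ) : ℂ)⁻¹).re := by
  set w := z ^ ((2 : ℕ) : ℂ)⁻¹ with hw
  have hsq : w ^ 2 = z := Complex.cpow_nat_inv_pow z two_ne_zero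
  have hre : 0 ≤ w.re := by
    rw [hw, Complex.cpow_def_of_ne_zero (by rintro rfl; simp at hz), Complex.exp_re]
    refine mul_nonneg (Real.exp_pos _).le (Real.cos_nonneg_of_mem_Icc ?_)
    have h1 := Complex.neg_pi_lt_arg z
    have h2 := Complex.arg_le_pi z
    have : (Complex.log z * ((2 : ℕ) : ℂ)⁻¹).im = z.arg / 2 := by
      rw [show ((2 : ℕ) : ℂ)⁻¹ = ((2⁻¹ : ℝ) : ℂ) by push_cast; rfl, Complex.im_mul_ofReal,
        Complex.log_im]
      ring
    rw [this]; constructor <;> linarith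
  have h3 : w.re ^ 2 - w.im ^ 2 = z.re := by rw [← hsq, pow_two w, Complex.mul_re]; ring
  have h4 : ‖z‖ = w.re ^ 2 + w.im ^ 2 := by
    rw [← hsq, norm_pow, ← Complex.normSq_eq_norm_sq, Complex.normSq_apply]; ring
  rw [show w.re = √(w.re ^ 2) from (Real.sqrt_sq hre).symm, ← Real.sqrt_mul (by norm_num)]
  exact Real.sqrt_le_sqrt (by linarith)

theorem integral_comp_fourier_one (h : ℂ → ℂ) (r : ℝ) :
    ∫ θ : UnitAddCircle, h (r * fourier 1 θ) = Real.circleAverage h 0 r := by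
  rw [← UnitAddCircle.intervalIntegral_preimage 0, Real.circleAverage_def]
  have h2 := intervalIntegral.integral_comp_mul_left (a := 0) (b := 1)
    (fun x => h (circleMap 0 r x)) (c := 2 * Real.pi) (by positivity)
  simp only [mul_zero, mul_one] at h2
  rw [← h2, zero_add]
  refine intervalIntegral.integral_congr fun x _ => ?_
  simp only [circleMap_zero, fourier_coe_apply]
  congr 3
  push_cast; ring

/-- Kolmogorov's bound: the square root of `invSum s` is holomorphic with real part comparable to
its modulus, so the mean value property bounds its `L¹` norm on a circle by its value at `0`. -/
theorem lintegral_sqrt_norm_invSum_le {s : Multiset ℂ} (hs : ∀ c ∈ s, ‖c‖ ≤ 1) {r : ℝ}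
    (hr0 : 0 ≤ r) (hr1 : r < 1) :
    ∫⁻ θ : UnitAddCircle, ENNReal.ofReal √‖invSum s (r * fourier 1 θ)‖
      ≤ ENNReal.ofReal (√2 * √s.card) := by
  rcases eq_or_ne s 0 with rfl | h0
  · simp
  set W : ℂ → ℂ := fun w => invSum s w ^ ((2 : ℕ) : ℂ)⁻¹ with hW
  have hd : ∀ w : ℂ, ‖w‖ < 1 → DifferentiableAt ℂ W w := fun w hw => by
    refine DifferentiableAt.cpow_const (differentiableAt_invSum fun c hc h => ?_)
      (Or.inl (re_invSum_pos h0 hs hw))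
    have := norm_mul_lt_one (hs c hc) hw
    rw [h] at this; simp at this
  have hn : ∀ θ : UnitAddCircle, ‖(r * fourier 1 θ : ℂ)‖ < 1 := fun θ => by
    simp [fourier_apply, abs_of_nonneg hr0, hr1, Circle.norm_coe]
  have hav : Real.circleAverage W 0 r = W 0 := by
    refine DiffContOnCl.circleAverage (DifferentiableOn.diffContOnCl fun w hw => ?_)
    refine (hd w ?_).differentiableWithinAt
    have := Metric.closure_ball_subset_closedBall hw
    rw [abs_of_nonneg hr0] at this
    simpa using lt_of_le_of_lt (by simpa using this) hr1
  have hcont : Continuous fun θ : UnitAddCircle => W (r * fourier 1 θ) := by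
    refine continuous_iff_continuousAt.2 fun θ => ?_
    exact ContinuousAt.comp (f := fun θ : UnitAddCircle => (r * fourier 1 θ : ℂ))
      (hd _ (hn θ)).continuousAt (by fun_prop)
  have hint : Integrable fun θ : UnitAddCircle => W (r * fourier 1 θ) :=
    hcont.integrable_of_hasCompactSupport (HasCompactSupport.of_compactSpace _)
  have hre : ∀ θ : UnitAddCircle, √‖invSum s (r * fourier 1 θ)‖ ≤ √2 * (W (r * fourier 1 θ)).re :=
    fun θ => sqrt_norm_le_re_cpow (re_invSum_pos h0 hs (hn θ))
  calc _ ≤ ∫⁻ θ : UnitAddCircle, ENNReal.ofReal (√2 * (W (r * fourier 1 θ)).re) :=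
        lintegral_mono fun θ => ENNReal.ofReal_le_ofReal (hre θ)
    _ = ENNReal.ofReal (∫ θ : UnitAddCircle, √2 * (W (r * fourier 1 θ)).re) := by
        refine (ofReal_integral_eq_lintegral_ofReal (hint.re.const_mul _) ?_).symm
        exact Filter.Eventually.of_forall fun θ => (Real.sqrt_nonneg _).trans (hre θ)
    _ ≤ _ := by
        refine ENNReal.ofReal_le_ofReal ?_
        rw [integral_const_mul]
        refine mul_le_mul_of_nonneg_left ?_ (Real.sqrt_nonneg _)
        have h1 : ∫ θ : UnitAddCircle, (W (r * fourier 1 θ)).re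
            = (∫ θ : UnitAddCircle, W (r * fourier 1 θ)).re := integral_re hint
        rw [h1, integral_comp_fourier_one, hav]
        refine (Complex.re_le_norm _).trans (Real.le_sqrt_of_sq_le ?_)
        rw [← norm_pow, hW]
        simp only
        rw [Complex.cpow_nat_inv_pow _ two_ne_zero, invSum_zero]
        simp

theorem ae_mul_fourier_one_ne (s : Multiset ℂ) :
    ∀ᵐ θ : UnitAddCircle, ∀ c ∈ s, c * fourier 1 θ ≠ 1 := by
  have : {c | c ∈ s}.Countable := (Multiset.finite_toSet s).countable
  refine (ae_ball_iff this).2 fun c _ => ?_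
  have hsub : {θ : UnitAddCircle | c * fourier 1 θ = 1}.Subsingleton := by
    intro θ h θ' h'
    simp only [Set.mem_ofPred_eq, fourier_one] at h h'
    have hc : c ≠ 0 := by rintro rfl; simp at h
    exact AddCircle.injective_toCircle one_ne_zero
      (Subtype.ext (mul_left_cancel₀ hc (h.trans h'.symm)))
  rw [ae_iff]
  simp only [ne_eq, not_not]
  rcases hsub.eq_empty_or_singleton with h | ⟨x, h⟩
  · rw [h, measure_empty]
  · rw [h, ← Metric.closedBall_zero, AddCircle.volume_closedBall]
    simp

theorem measurable_invSum_fourier (s : Multiset ℂ) :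
    Measurable fun θ : UnitAddCircle => invSum s (fourier 1 θ) := by
  induction s using Multiset.induction_on with
  | empty => simp
  | cons a s ih =>
    simp only [invSum_cons]
    refine Measurable.add (Measurable.inv ?_) ih
    exact (by fun_prop : Continuous fun θ : UnitAddCircle => 1 - a * fourier 1 θ).measurable

/-- Weak type bound for boundary values of `invSum`, uniform in the parameters. -/
theorem volume_lt_norm_invSum_le {s : Multiset ℂ} (hs : ∀ c ∈ s, ‖c‖ ≤ 1) {t : ℝ} (ht : 0 < t) :
    volume {θ : UnitAddCircle | t * s.card < ‖invSum s (fourier 1 θ)‖}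
      ≤ ENNReal.ofReal (√2 / √t) := by
  rcases eq_or_ne s 0 with rfl | h0
  · simp
  have hcard : (0 : ℝ) < s.card := by exact_mod_cast Multiset.card_pos.2 h0
  -- Boundary values are reached by Fatou's lemma along radii `r n` that increase to `1`.
  set r : ℕ → ℝ := fun n => 1 - 1 / ((n : ℝ) + 2) with hr
  have hr0 : ∀ n, 0 ≤ r n := fun n => by
    simp only [hr, sub_nonneg]
    rw [div_le_one (by positivity)]; linarith [(Nat.cast_nonneg n : (0 : ℝ) ≤ n)]
  have hr1 : ∀ n, r n < 1 := fun n => by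
    have : (0 : ℝ) < 1 / ((n : ℝ) + 2) := by positivity
    simp only [hr]; linarith
  have hrt : Filter.Tendsto r Filter.atTop (nhds 1) := by
    have : Filter.Tendsto (fun n : ℕ => 1 / ((n : ℝ) + 2)) Filter.atTop (nhds 0) := by
      refine Filter.Tendsto.div_atTop tendsto_const_nhds ?_
      exact Filter.tendsto_atTop_add_const_right _ _ tendsto_natCast_atTop_atTop
    simpa [hr] using (tendsto_const_nhds (x := (1 : ℝ))).sub this
  have hlim : ∀ᵐ θ : UnitAddCircle, ENNReal.ofReal √‖invSum s (fourier 1 θ)‖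
      ≤ Filter.liminf (fun n => ENNReal.ofReal √‖invSum s (r n * fourier 1 θ)‖) Filter.atTop := by
    filter_upwards [ae_mul_fourier_one_ne s] with θ hθ
    refine (Filter.Tendsto.liminf_eq ?_).ge
    have h1 : Filter.Tendsto (fun n => (r n * fourier 1 θ : ℂ)) Filter.atTop
        (nhds (fourier 1 θ)) := by
      have h2 := ((Complex.continuous_ofReal.tendsto 1).comp hrt).mul_const (fourier 1 θ)
      simpa using! h2
    have h3 := ((differentiableAt_invSum hθ).continuousAt.tendsto.comp h1).norm
    exact (ENNReal.continuous_ofReal.tendsto _).comp ((Real.continuous_sqrt.tendsto _).comp h3)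
  have hmeas : ∀ n, Measurable fun θ : UnitAddCircle =>
      ENNReal.ofReal √‖invSum s (r n * fourier 1 θ)‖ := fun n => by
    refine ENNReal.measurable_ofReal.comp (Real.continuous_sqrt.measurable.comp
      (Measurable.norm ?_))
    have h := measurable_invSum_fourier (s.map fun c => c * r n)
    have e : ∀ θ : UnitAddCircle, invSum (s.map fun c => c * r n) (fourier 1 θ)
        = invSum s (r n * fourier 1 θ) := fun θ => by
      simp [invSum, Multiset.map_map, mul_assoc]
    simpa only [e] using h
  have hI : ∫⁻ θ : UnitAddCircle, ENNReal.ofReal √‖invSum s (fourier 1 θ)‖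
      ≤ ENNReal.ofReal (√2 * √s.card) := by
    refine (lintegral_mono_ae hlim).trans ((lintegral_liminf_le hmeas).trans ?_)
    refine Filter.liminf_le_of_frequently_le' (Filter.Frequently.of_forall fun n => ?_)
    exact lintegral_sqrt_norm_invSum_le hs (hr0 n) (hr1 n)
  have hpos : 0 < √(t * s.card) := Real.sqrt_pos.2 (mul_pos ht hcard)
  have hM := meas_ge_le_lintegral_div (μ := (volume : Measure UnitAddCircle))
    (f := fun θ => ENNReal.ofReal √‖invSum s (fourier 1 θ)‖)
    (ENNReal.measurable_ofReal.comp (Real.continuous_sqrt.measurable.comp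
      (measurable_invSum_fourier s).norm)).aemeasurable
    (ε := ENNReal.ofReal √(t * s.card)) (ENNReal.ofReal_pos.2 hpos).ne' ENNReal.ofReal_ne_top
  refine (measure_mono fun θ hθ => ?_).trans (hM.trans ((ENNReal.div_le_div_right hI _).trans ?_))
  · exact ENNReal.ofReal_le_ofReal (Real.sqrt_le_sqrt (le_of_lt hθ))
  · rw [← ENNReal.ofReal_div_of_pos hpos]
    refine ENNReal.ofReal_le_ofReal (le_of_eq ?_)
    rw [Real.sqrt_mul ht.le]
    field_simp

/-! ### A Turán type lemma for exponential sums -/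

/-- The exponential sum `∑_{k ∈ S} c_k e^{2πikθ}`. -/
noncomputable def trigSum (S : Finset ℤ) (c : ℤ → ℂ) (θ : UnitAddCircle) : ℂ :=
  ∑ k ∈ S, c k * fourier k θ

theorem continuous_trigSum (S : Finset ℤ) (c : ℤ → ℂ) : Continuous (trigSum S c) := by
  unfold trigSum; fun_prop

theorem norm_fourier_apply (k : ℤ) (θ : UnitAddCircle) : ‖fourier k θ‖ = 1 := by
  simp [fourier_apply, Circle.norm_coe]

theorem mul_inv_sub_eq_conj {z a : ℂ} (hz : ‖z‖ = 1) :
    z * (1 / (z - a)) = starRingEnd ℂ (1 - starRingEnd ℂ a * z)⁻¹ := by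
  have h0 : z ≠ 0 := by rintro rfl; simp at hz
  have h1 : z * starRingEnd ℂ z = 1 := by rw [Complex.mul_conj, Complex.normSq_eq_norm_sq, hz]; simp
  have h2 : z - a = z * (1 - a * starRingEnd ℂ z) := by linear_combination a * h1
  rw [h2, map_inv₀]
  simp only [map_sub, map_one, map_mul, Complex.conj_conj, one_div, mul_inv]
  rw [mul_inv_cancel_left₀ h0]

theorem mul_inv_sub_eq_one_sub {z a : ℂ} (h : z ≠ a) (ha : a ≠ 0) :
    z * (1 / (z - a)) = 1 - (1 - a⁻¹ * z)⁻¹ := by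
  have h1 : z - a ≠ 0 := sub_ne_zero.2 h
  have h2 : 1 - a⁻¹ * z = -(z - a) * a⁻¹ := by field_simp; ring
  rw [h2, mul_inv, inv_inv, inv_neg]
  field_simp
  ring

/-- The logarithmic derivative of a polynomial on the unit circle, split according to whether the
roots lie in the closed unit disc: each root contributes a function with one-signed real part. -/
theorem mul_sum_inv_sub_roots (s : Multiset ℂ) {z : ℂ} (hz : ‖z‖ = 1) :
    z * (s.map fun a => 1 / (z - a)).sum =
      starRingEnd ℂ (invSum ((s.filter fun a => ‖a‖ ≤ 1).map (starRingEnd ℂ)) z)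
        + ((s.filter fun a => ¬ ‖a‖ ≤ 1).card
            - invSum ((s.filter fun a => ¬ ‖a‖ ≤ 1).map fun a => a⁻¹) z) := by
  induction s using Multiset.induction_on with
  | empty => simp
  | cons a s ih =>
    rw [Multiset.map_cons, Multiset.sum_cons, mul_add, ih]
    by_cases h : ‖a‖ ≤ 1
    · rw [mul_inv_sub_eq_conj hz]
      simp only [Multiset.filter_cons_of_pos (p := fun a : ℂ => ‖a‖ ≤ 1) s h,
        Multiset.filter_cons_of_neg (p := fun a : ℂ => ¬ ‖a‖ ≤ 1) s (not_not.2 h),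
        Multiset.map_cons, invSum_cons, map_add]
      ring
    · have h1 : z ≠ a := by rintro rfl; exact h hz.le
      have h2 : a ≠ 0 := by rintro rfl; simp at h
      rw [mul_inv_sub_eq_one_sub h1 h2]
      simp only [Multiset.filter_cons_of_neg (p := fun a : ℂ => ‖a‖ ≤ 1) s h,
        Multiset.filter_cons_of_pos (p := fun a : ℂ => ¬ ‖a‖ ≤ 1) s h,
        Multiset.map_cons, invSum_cons, Multiset.card_cons]
      push_cast
      ring

/-- Weak type bound for the logarithmic derivative of a polynomial on the unit circle. The scale is
the degree, and the measure of the exceptional set does not depend on it. -/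
theorem volume_lt_norm_derivative_le (R : Polynomial ℂ) {d : ℕ} (hd : R.natDegree ≤ d) {t : ℝ}
    (ht : 0 < t) :
    volume {θ : UnitAddCircle | d * (1 + t) * ‖R.eval (fourier 1 θ)‖
        < ‖fourier 1 θ * R.derivative.eval (fourier 1 θ)‖}
      ≤ ENNReal.ofReal (2 * √2 / √t) := by
  rcases eq_or_ne R 0 with rfl | hR
  · simp
  set s₁ := (R.roots.filter fun a => ‖a‖ ≤ 1).map (starRingEnd ℂ) with hs₁
  set s₂ := (R.roots.filter fun a => ¬ ‖a‖ ≤ 1).map fun a => a⁻¹ with hs₂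
  have h₁ := volume_lt_norm_invSum_le (s := s₁) (by
    intro c hc
    obtain ⟨a, ha, rfl⟩ := Multiset.mem_map.1 hc
    simpa using (Multiset.mem_filter.1 ha).2) ht
  have h₂ := volume_lt_norm_invSum_le (s := s₂) (by
    intro c hc
    obtain ⟨a, ha, rfl⟩ := Multiset.mem_map.1 hc
    have := (Multiset.mem_filter.1 ha).2
    rw [norm_inv]
    exact inv_le_one_of_one_le₀ (not_le.1 this).le) ht
  have h₃ := ae_mul_fourier_one_ne (R.roots.map fun a => a⁻¹)
  rw [ae_iff] at h₃
  refine (measure_mono (t := ({θ : UnitAddCircle | t * s₁.card < ‖invSum s₁ (fourier 1 θ)‖} ∪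
    {θ : UnitAddCircle | t * s₂.card < ‖invSum s₂ (fourier 1 θ)‖}) ∪
    {θ | ¬ ∀ c ∈ R.roots.map fun a => a⁻¹, c * fourier 1 θ ≠ 1}) ?_).trans ?_
  · intro θ hθ
    by_contra hcon
    simp only [Set.mem_union, Set.mem_ofPred_eq, not_or, not_lt, not_not] at hcon hθ
    obtain ⟨⟨g₁, g₂⟩, g₃⟩ := hcon
    set z : ℂ := fourier 1 θ with hz
    have hz1 : ‖z‖ = 1 := norm_fourier_apply 1 θ
    have hz0 : z ≠ 0 := by rintro h; simp [h] at hz1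
    have hev : R.eval z ≠ 0 := fun h0 => by
      refine g₃ z⁻¹ (Multiset.mem_map.2 ⟨z, (Polynomial.mem_roots hR).2 h0, rfl⟩) ?_
      exact inv_mul_cancel₀ hz0
    have hlog := (IsAlgClosed.splits R).eval_derivative_div_eval_of_ne_zero hev
    have hder : z * R.derivative.eval z =
        (z * (R.roots.map fun a => 1 / (z - a)).sum) * R.eval z := by
      rw [← hlog]; field_simp
    refine not_le.2 hθ ?_
    rw [hder, mul_sum_inv_sub_roots _ hz1, norm_mul]
    refine mul_le_mul_of_nonneg_right ?_ (norm_nonneg _)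
    have hcard : (s₁.card : ℝ) + s₂.card ≤ d := by
      have e : s₁.card + s₂.card = R.roots.card := by
        rw [hs₁, hs₂, Multiset.card_map, Multiset.card_map, ← Multiset.card_add,
          Multiset.filter_add_not]
      have := e.le.trans (R.card_roots'.trans hd)
      exact_mod_cast this
    have hs₂c : (R.roots.filter fun a => ¬ ‖a‖ ≤ 1).card = s₂.card := by rw [hs₂, Multiset.card_map]
    rw [hs₂c]
    have k₁ : ‖starRingEnd ℂ (invSum s₁ z)‖ ≤ t * s₁.card := by simpa using g₁
    have k₂ : ‖(s₂.card : ℂ) - invSum s₂ z‖ ≤ s₂.card + t * s₂.card :=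
      (norm_sub_le _ _).trans (add_le_add (by simp) g₂)
    refine (norm_add_le _ _).trans ((add_le_add k₁ k₂).trans ?_)
    have : (0 : ℝ) ≤ s₁.card := Nat.cast_nonneg _
    nlinarith
  · refine (measure_union_le _ _).trans ?_
    rw [h₃, add_zero]
    refine (measure_union_le _ _).trans ((add_le_add h₁ h₂).trans (le_of_eq ?_))
    rw [← ENNReal.ofReal_add (by positivity) (by positivity)]
    congr 1; ring

theorem fourier_eq_mul_pow {a k : ℤ} (h : a ≤ k) (θ : UnitAddCircle) :
    (fourier k θ : ℂ) = fourier a θ * fourier 1 θ ^ (k - a).toNat := by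
  obtain ⟨n, rfl⟩ := Int.le.dest h
  have : (a + n - a).toNat = n := by omega
  rw [this, fourier_add]
  congr 1
  simp [fourier_apply, AddCircle.toCircle_nsmul]

/-- Weak type bound for the operation that removes the lowest or the highest frequency `l` of an
exponential sum `p` by passing to `p' / (2πi) - l p`. -/
theorem volume_lt_norm_trigSum_mul_sub_le (S : Finset ℤ) (c : ℤ → ℂ) {a b l : ℤ} (hab : a ≤ b)
    (hS : ∀ k ∈ S, a ≤ k ∧ k ≤ b) (hl : l = a ∨ l = b) {t : ℝ} (ht : 0 < t) :
    volume {θ | ((b - a : ℤ) : ℝ) * (2 + t) * ‖trigSum S c θ‖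
        < ‖trigSum S (fun k => c k * ((k - l : ℤ) : ℂ)) θ‖}
      ≤ ENNReal.ofReal (2 * √2 / √t) := by
  set R : Polynomial ℂ := ∑ k ∈ S, Polynomial.monomial (k - a).toNat (c k) with hR
  have hdeg : R.natDegree ≤ (b - a).toNat := by
    refine Polynomial.natDegree_sum_le_of_forall_le _ _ fun k hk => ?_
    refine (Polynomial.natDegree_monomial_le _).trans ?_
    have := hS k hk; omega
  refine (measure_mono ?_).trans (volume_lt_norm_derivative_le R hdeg ht)
  intro θ hθ
  simp only [Set.mem_ofPred_eq] at hθ ⊢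
  set z : ℂ := fourier 1 θ with hz
  have hp : trigSum S c θ = fourier a θ * R.eval z := by
    rw [hR, Polynomial.eval_finsetSum, trigSum, Finset.mul_sum]
    refine Finset.sum_congr rfl fun k hk => ?_
    rw [fourier_eq_mul_pow (hS k hk).1, Polynomial.eval_monomial]; ring
  have hp' : trigSum S (fun k => c k * ((k - l : ℤ) : ℂ)) θ
      = fourier a θ * (z * R.derivative.eval z - ((l - a : ℤ) : ℂ) * R.eval z) := by
    rw [hR, Polynomial.derivative_sum, Polynomial.eval_finsetSum, Polynomial.eval_finsetSum,
      trigSum, Finset.mul_sum, Finset.mul_sum, ← Finset.sum_sub_distrib, Finset.mul_sum]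
    refine Finset.sum_congr rfl fun k hk => ?_
    rw [fourier_eq_mul_pow (hS k hk).1, Polynomial.derivative_monomial, Polynomial.eval_monomial,
      Polynomial.eval_monomial]
    have hn : ((k - a : ℤ) : ℂ) = ((k - a).toNat : ℂ) := by
      have : ((k - a).toNat : ℤ) = k - a := Int.toNat_of_nonneg (by have := hS k hk; omega)
      exact_mod_cast this.symm
    have hkl : ((k - l : ℤ) : ℂ) = ((k - a).toNat : ℂ) - ((l - a : ℤ) : ℂ) := by
      rw [← hn]; push_cast; ring
    rw [hkl]
    rcases Nat.eq_zero_or_pos (k - a).toNat with h0 | h0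
    · rw [h0]; simp; ring
    · obtain ⟨m, hm⟩ := Nat.exists_eq_succ_of_ne_zero h0.ne'
      rw [hm]; simp only [Nat.succ_eq_add_one, Nat.add_sub_cancel, pow_succ]; ring
  rw [hp, hp', norm_mul, norm_mul, norm_fourier_apply, one_mul, one_mul] at hθ
  have hd : (((b - a).toNat : ℕ) : ℝ) = ((b - a : ℤ) : ℝ) := by
    have : ((b - a).toNat : ℤ) = b - a := Int.toNat_of_nonneg (by omega)
    exact_mod_cast this
  rw [hd]
  have hla : ‖((l - a : ℤ) : ℂ)‖ ≤ ((b - a : ℤ) : ℝ) := by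
    rw [Complex.norm_intCast]
    have : |l - a| ≤ b - a := by rcases hl with rfl | rfl <;> simp [abs_of_nonneg, hab]
    exact_mod_cast this
  have h1 := norm_sub_le (z * R.derivative.eval z) (((l - a : ℤ) : ℂ) * R.eval z)
  rw [norm_mul ((l - a : ℤ) : ℂ)] at h1
  have h2 := mul_le_mul_of_nonneg_right hla (norm_nonneg (R.eval z))
  nlinarith

/-- A Turán type lemma: an exponential sum is rarely much smaller than one of its coefficients. The
bound depends on the number of frequencies only. The frequencies other than `k₀` are removed
one by one, always the extreme one farther from `k₀`, which costs at most half the coefficient. -/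
theorem volume_norm_trigSum_lt_le {t : ℝ} (ht : 0 < t) (n : ℕ) :
    ∀ (S : Finset ℤ) (c : ℤ → ℂ) (k₀ : ℤ), k₀ ∈ S → S.card = n + 1 →
      volume {θ | ‖trigSum S c θ‖ < ‖c k₀‖ / (2 * (2 + t)) ^ n}
        ≤ n * ENNReal.ofReal (2 * √2 / √t) := by
  induction n with
  | zero =>
    intro S c k₀ hk hS
    obtain ⟨k, rfl⟩ := Finset.card_eq_one.1 hS
    obtain rfl := Finset.mem_singleton.1 hk
    simp [trigSum, Circle.norm_coe]
  | succ n ih =>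
    intro S c k₀ hk hS
    have hne : S.Nonempty := ⟨k₀, hk⟩
    set a := S.min' hne with ha
    set b := S.max' hne with hb
    have hSab : ∀ k ∈ S, a ≤ k ∧ k ≤ b := fun k hk => ⟨S.min'_le k hk, S.le_max' k hk⟩
    have hab : a < b := Finset.min'_lt_max'_of_card _ (by omega)
    obtain ⟨l, hl, hlS, hfar⟩ : ∃ l, (l = a ∨ l = b) ∧ l ∈ S ∧ b - a ≤ 2 * |k₀ - l| := by
      have := hSab k₀ hk
      by_cases h : b - a ≤ 2 * (k₀ - a)
      · exact ⟨a, Or.inl rfl, S.min'_mem hne, by rwa [abs_of_nonneg (by omega)]⟩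
      · refine ⟨b, Or.inr rfl, S.max'_mem hne, ?_⟩
        rw [abs_of_nonpos (by omega)]; omega
    have hd : (0 : ℝ) < ((b - a : ℤ) : ℝ) := by exact_mod_cast (by omega : 0 < b - a)
    have hk₀l : k₀ ≠ l := by rintro rfl; simp at hfar; omega
    set c' : ℤ → ℂ := fun k => c k * ((k - l : ℤ) : ℂ) / ((b - a : ℤ) : ℂ) with hc'
    have hc'k : ‖c k₀‖ / 2 ≤ ‖c' k₀‖ := by
      have h1 : ((b - a : ℤ) : ℝ) ≤ 2 * ((|k₀ - l| : ℤ) : ℝ) := by exact_mod_cast hfar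
      simp only [hc']
      rw [norm_div, norm_mul, Complex.norm_intCast, Complex.norm_intCast, abs_of_pos hd,
        le_div_iff₀ hd]
      rw [Int.cast_abs] at h1
      nlinarith [norm_nonneg (c k₀)]
    have hsum : ∀ θ, trigSum S (fun k => c k * ((k - l : ℤ) : ℂ)) θ
        = ((b - a : ℤ) : ℂ) * trigSum (S.erase l) c' θ := fun θ => by
      rw [trigSum, ← Finset.add_sum_erase _ _ hlS, trigSum, Finset.mul_sum]
      simp only [sub_self, Int.cast_zero, mul_zero, zero_mul, zero_add, hc']
      refine Finset.sum_congr rfl fun k _ => ?_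
      have : ((b - a : ℤ) : ℂ) ≠ 0 := by exact_mod_cast (by omega : b - a ≠ 0)
      field_simp
    have hD := volume_lt_norm_trigSum_mul_sub_le S c hab.le hSab hl ht
    have hI := ih (S.erase l) c' k₀ (Finset.mem_erase.2 ⟨hk₀l, hk⟩)
      (by rw [Finset.card_erase_of_mem hlS, hS]; rfl)
    refine (measure_mono (t := {θ | ((b - a : ℤ) : ℝ) * (2 + t) * ‖trigSum S c θ‖
        < ‖trigSum S (fun k => c k * ((k - l : ℤ) : ℂ)) θ‖} ∪
        {θ | ‖trigSum (S.erase l) c' θ‖ < ‖c' k₀‖ / (2 * (2 + t)) ^ n}) ?_).trans ?_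
    · intro θ hθ
      by_contra hcon
      simp only [Set.mem_union, Set.mem_ofPred_eq, not_or, not_lt, hsum, norm_mul,
        Complex.norm_intCast, abs_of_pos hd] at hcon hθ
      obtain ⟨g₁, g₂⟩ := hcon
      rw [mul_assoc] at g₁
      have g₃ := le_of_mul_le_mul_left g₁ hd
      have hq : 0 < (2 * (2 + t)) ^ n := by positivity
      rw [lt_div_iff₀ (by positivity), pow_succ] at hθ
      rw [div_le_iff₀ hq] at g₂
      have g₄ := mul_le_mul_of_nonneg_right g₃ hq.le
      nlinarith
    · refine (measure_union_le _ _).trans ((add_le_add hD hI).trans (le_of_eq ?_))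
      push_cast; ring

/-! ### Small ball estimates for Rademacher sums -/

section RademacherSums

variable {Ω : Type*} [MeasurableSpace Ω] {P : Measure Ω} {ξ : ℤ → Ω → ℝ}

theorem IsRademacherSeq.abs_eq_one (hξ : IsRademacherSeq P ξ) (k : ℤ) (ω : Ω) : |ξ k ω| = 1 := by
  rcases hξ.eq_one_or k ω with h | h <;> simp [h]

theorem IsRademacherSeq.integrable [IsProbabilityMeasure P] (hξ : IsRademacherSeq P ξ) (k : ℤ) :
    Integrable (ξ k) P :=
  Integrable.of_bound (hξ.measurable k).aestronglyMeasurable 1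
    (Filter.Eventually.of_forall fun ω => by simp [hξ.abs_eq_one k ω])

theorem IsRademacherSeq.integral_eq_zero [IsProbabilityMeasure P] (hξ : IsRademacherSeq P ξ)
    (k : ℤ) : ∫ ω, ξ k ω ∂P = 0 := by
  have hm : MeasurableSet {ω | ξ k ω = 1} := hξ.measurable k (measurableSet_singleton 1)
  have h : ∀ ω, ξ k ω = 2 * Set.indicator {ω | ξ k ω = 1} (fun _ => (1 : ℝ)) ω - 1 := fun ω => by
    rcases hξ.eq_one_or k ω with h | h
    · rw [Set.indicator_of_mem (by exact h), h]; norm_num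
    · rw [Set.indicator_of_notMem (by simp only [Set.mem_ofPred_eq]; rw [h]; norm_num), h]; norm_num
  rw [integral_congr_ae (Filter.Eventually.of_forall h),
    integral_sub (((integrable_const _).indicator hm).const_mul _) (integrable_const _),
    integral_const_mul, integral_indicator_const _ hm, measureReal_def, hξ.prob_one]
  simp

theorem IsRademacherSeq.integral_cexp [IsProbabilityMeasure P] (hξ : IsRademacherSeq P ξ) (k : ℤ)
    (x : ℝ) : ∫ ω, Complex.exp (Complex.I * (x * ξ k ω)) ∂P = Real.cos x := by
  have h : ∀ ω, Complex.exp (Complex.I * (x * ξ k ω))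
      = Complex.cos x + (ξ k ω : ℂ) * (Complex.sin x * Complex.I) := fun ω => by
    rw [mul_comm Complex.I]
    rcases hξ.eq_one_or k ω with h | h
    · rw [h, Complex.ofReal_one, mul_one, Complex.exp_mul_I]; ring
    · rw [h, Complex.ofReal_neg, Complex.ofReal_one, mul_neg_one, Complex.exp_mul_I,
        Complex.cos_neg, Complex.sin_neg]; ring
  simp_rw [h]
  rw [integral_add (integrable_const _) ((hξ.integrable k).ofReal.mul_const _),
    integral_mul_const, integral_complex_ofReal, hξ.integral_eq_zero k]
  simp

/-- The characteristic function of a Rademacher sum is a product of cosines. -/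
theorem IsRademacherSeq.integral_cos_sum [IsProbabilityMeasure P] (hξ : IsRademacherSeq P ξ)
    (S : Finset ℤ) (x : ℤ → ℝ) :
    ∫ ω, Real.cos (∑ k ∈ S, x k * ξ k ω) ∂P = ∏ k ∈ S, Real.cos (x k) := by
  have hind : iIndepFun (fun (k : S) ω => Complex.exp (Complex.I * (x k * ξ k ω))) P := by
    have h1 := hξ.indep.precomp (g := fun k : S => (k : ℤ)) Subtype.val_injective
    exact h1.comp (fun k y => Complex.exp (Complex.I * (x k * y))) fun k => by fun_prop
  have hm : ∀ k : S, AEStronglyMeasurable (fun ω => Complex.exp (Complex.I * (x k * ξ k ω))) P :=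
    fun k => by
      have := hξ.measurable k
      exact Measurable.aestronglyMeasurable (by fun_prop)
  have h2 := hind.integral_fun_prod_eq_prod_integral hm
  have h3 : ∀ ω, ∏ k : S, Complex.exp (Complex.I * (x k * ξ k ω))
      = Complex.exp ((∑ k ∈ S, x k * ξ k ω : ℝ) * Complex.I) := fun ω => by
    rw [← Complex.exp_sum, ← Finset.mul_sum, mul_comm, ← Finset.sum_coe_sort S]
    push_cast; rfl
  simp_rw [h3, hξ.integral_cexp] at h2
  have h4 : ∏ k : S, ((Real.cos (x k) : ℝ) : ℂ) = ((∏ k ∈ S, Real.cos (x k) : ℝ) : ℂ) := by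
    rw [← Finset.prod_coe_sort S]; push_cast; rfl
  rw [h4] at h2
  have h5 := congrArg Complex.re h2
  have hint : Integrable (fun ω => Complex.exp ((∑ k ∈ S, x k * ξ k ω : ℝ) * Complex.I)) P := by
    refine Integrable.of_bound (C := 1) ?_ (Filter.Eventually.of_forall fun ω => ?_)
    · have := hξ.measurable
      exact Measurable.aestronglyMeasurable (by fun_prop)
    · rw [Complex.norm_exp_ofReal_mul_I]
  have h6 : ∫ ω, (Complex.exp ((∑ k ∈ S, x k * ξ k ω : ℝ) * Complex.I)).re ∂P = _ :=
    integral_re hint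
  simp only [Complex.exp_ofReal_mul_I_re] at h6
  rw [h6]
  exact h5

end RademacherSums

/-- The sign pattern equal to `1` on `U` and to `-1` off `U`. -/
def signOf (U : Finset ℤ) (k : ℤ) : ℝ := if k ∈ U then 1 else -1

section RademacherSums

variable {Ω : Type*} [MeasurableSpace Ω] {P : Measure Ω} {ξ : ℤ → Ω → ℝ}

/-- If the signed sums of the `z k`, `k ∈ T`, are separated by `2δ`, then, conditionally on the
other signs, a Rademacher sum falls into a given `δ`-ball for at most one of the `2 ^ #T` sign
patterns on `T`. -/
theorem IsRademacherSeq.measure_norm_sum_lt_le [IsProbabilityMeasure P] (hξ : IsRademacherSeq P ξ)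
    {S T : Finset ℤ} (hT : T ⊆ S) (z : ℤ → ℂ) {δ : ℝ}
    (hsep : ∀ U ∈ T.powerset, ∀ V ∈ T.powerset, U ≠ V →
      2 * δ ≤ ‖∑ k ∈ T, ((signOf U k - signOf V k : ℝ) : ℂ) * z k‖) :
    P {ω | ‖∑ k ∈ S, (ξ k ω : ℂ) * z k‖ < δ} ≤ (1 / 2) ^ T.card := by
  set A : Finset ℤ → Set Ω := fun U => (fun ω (i : T) => ξ i ω) ⁻¹' {x | ∀ i : T, x i = signOf U i}
    with hA
  set B : Finset ℤ → Set Ω := fun U => (fun ω (i : (S \ T : Finset ℤ)) => ξ i ω) ⁻¹'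
    {x | ‖∑ k ∈ T, (signOf U k : ℂ) * z k + ∑ k : (S \ T : Finset ℤ), (x k : ℂ) * z k‖ < δ} with hB
  have hmA : ∀ U, MeasurableSet {x : T → ℝ | ∀ i : T, x i = signOf U i} := fun U => by
    rw [Set.ofPred_forall]
    exact MeasurableSet.iInter fun i => measurable_pi_apply i (measurableSet_singleton _)
  have hmB : ∀ U : Finset ℤ, MeasurableSet {x : (S \ T : Finset ℤ) → ℝ |
      ‖∑ k ∈ T, (signOf U k : ℂ) * z k + ∑ k : (S \ T : Finset ℤ), (x k : ℂ) * z k‖ < δ} :=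
    fun U => (isOpen_lt (by fun_prop) continuous_const).measurableSet
  have hPA : ∀ U, P (A U) = (1 / 2) ^ T.card := fun U => by
    have h := hξ.indep.measure_inter_preimage_eq_mul T (sets := fun k => {signOf U k})
      fun k _ => measurableSet_singleton _
    have h1 : A U = ⋂ k ∈ T, ξ k ⁻¹' {signOf U k} := by
      ext ω; simp [hA]
    rw [h1, h]
    refine (Finset.prod_congr rfl fun k _ => ?_).trans (Finset.prod_const _)
    unfold signOf
    split_ifs
    · exact hξ.prob_one k
    · exact hξ.prob_neg_one k
  have hmB' : ∀ U, MeasurableSet (B U) := fun U =>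
    (measurable_pi_lambda (fun ω (i : (S \ T : Finset ℤ)) => ξ i ω) fun i => hξ.measurable i)
      (hmB U)
  have hAB : ∀ U, P (A U ∩ B U) = (1 / 2) ^ T.card * P (B U) := fun U => by
    rw [← hPA U]
    exact (hξ.indep.indepFun_finset T (S \ T) Finset.disjoint_sdiff
      hξ.measurable).measure_inter_preimage_eq_mul _ _ (hmA U) (hmB U)
  have hsub : {ω | ‖∑ k ∈ S, (ξ k ω : ℂ) * z k‖ < δ} ⊆ ⋃ U ∈ T.powerset, A U ∩ B U := by
    intro ω hω
    have hU : ∀ k ∈ T, ξ k ω = signOf (T.filter fun k => ξ k ω = 1) k := fun k hk => by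
      rcases hξ.eq_one_or k ω with h | h <;> simp [signOf, hk, h]
    refine Set.mem_iUnion₂.2 ⟨T.filter fun k => ξ k ω = 1,
      Finset.mem_powerset.2 (Finset.filter_subset _ _), fun i => hU i i.2, ?_⟩
    have h1 : ∑ k ∈ T, (signOf (T.filter fun k => ξ k ω = 1) k : ℂ) * z k
        = ∑ k ∈ T, (ξ k ω : ℂ) * z k :=
      Finset.sum_congr rfl fun k hk => by rw [← hU k hk]
    change ‖_ + ∑ k : (S \ T : Finset ℤ), (ξ k ω : ℂ) * z k‖ < δ
    rw [h1, Finset.sum_coe_sort (S \ T) fun k => (ξ k ω : ℂ) * z k, add_comm,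
      Finset.sum_sdiff hT]
    exact hω
  have hdisj : (T.powerset : Set (Finset ℤ)).PairwiseDisjoint B := by
    intro U hU V hV hUV
    refine Set.disjoint_left.2 fun ω h1 h2 => ?_
    have h3 := hsep U hU V hV hUV
    simp only [hB, Set.mem_preimage, Set.mem_ofPred_eq] at h1 h2
    have h4 := norm_sub_le (∑ k ∈ T, (signOf U k : ℂ) * z k
      + ∑ k : (S \ T : Finset ℤ), (ξ k ω : ℂ) * z k) (∑ k ∈ T, (signOf V k : ℂ) * z k
      + ∑ k : (S \ T : Finset ℤ), (ξ k ω : ℂ) * z k)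
    rw [add_sub_add_right_eq_sub, ← Finset.sum_sub_distrib] at h4
    simp only [Complex.ofReal_sub, sub_mul] at h3
    linarith
  calc _ ≤ P (⋃ U ∈ T.powerset, A U ∩ B U) := measure_mono hsub
    _ ≤ ∑ U ∈ T.powerset, P (A U ∩ B U) := measure_biUnion_finset_le _ _
    _ = (1 / 2) ^ T.card * P (⋃ U ∈ T.powerset, B U) := by
        rw [measure_biUnion_finset hdisj fun U _ => hmB' U, Finset.mul_sum]
        exact Finset.sum_congr rfl fun U _ => hAB U
    _ ≤ _ := mul_le_of_le_one_right' prob_le_one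

theorem integral_one_sub_mul_cos (x : ℝ) (hx : x ≠ 0) :
    ∫ s in (0 : ℝ)..1, (1 - s) * Real.cos (s * x) = (1 - Real.cos x) / x ^ 2 := by
  have h : ∀ s ∈ Set.uIcc (0 : ℝ) 1, HasDerivAt
      (fun s => (1 - s) * Real.sin (s * x) / x - Real.cos (s * x) / x ^ 2)
      ((1 - s) * Real.cos (s * x)) s := fun s _ => by
    have h0 : HasDerivAt (fun s : ℝ => s * x) x s := by simpa using (hasDerivAt_id s).mul_const x
    have h1 : HasDerivAt (fun s : ℝ => 1 - s) (-1) s := by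
      simpa using (hasDerivAt_id s).const_sub 1
    refine (((h1.mul h0.sin).div_const x).sub (h0.cos.div_const (x ^ 2))).congr_deriv ?_
    field_simp
    ring
  rw [intervalIntegral.integral_eq_sub_of_hasDerivAt h
    (Continuous.intervalIntegrable (by fun_prop) _ _)]
  simp
  ring

/-- The Fejér kernel on the line is nonnegative. -/
theorem integral_one_sub_mul_cos_nonneg (x : ℝ) :
    0 ≤ ∫ s in (0 : ℝ)..1, (1 - s) * Real.cos (s * x) := by
  rcases eq_or_ne x 0 with rfl | hx
  · refine intervalIntegral.integral_nonneg zero_le_one fun s hs => ?_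
    simpa using hs.2
  · rw [integral_one_sub_mul_cos x hx]
    exact div_nonneg (sub_nonneg.2 (Real.cos_le_one x)) (sq_nonneg x)

theorem quarter_le_integral_one_sub_mul_cos {x : ℝ} (hx : |x| ≤ 1) :
    1 / 4 ≤ ∫ s in (0 : ℝ)..1, (1 - s) * Real.cos (s * x) := by
  have h : ∫ s in (0 : ℝ)..1, (1 - s) * (1 / 2) = 1 / 4 := by
    rw [intervalIntegral.integral_mul_const, intervalIntegral.integral_sub (by simp) (by simp)]
    simp; norm_num
  rw [← h]
  refine intervalIntegral.integral_mono_on zero_le_one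
    (Continuous.intervalIntegrable (by fun_prop) _ _)
    (Continuous.intervalIntegrable (by fun_prop) _ _) fun s hs => ?_
  refine mul_le_mul_of_nonneg_left ?_ (sub_nonneg.2 hs.2)
  have h1 : |s * x| ≤ 1 := by
    rw [abs_mul, abs_of_nonneg hs.1]
    exact mul_le_one₀ hs.2 (abs_nonneg _) hx
  have h2 := Real.one_sub_sq_div_two_le_cos (x := s * x)
  have h3 : (s * x) ^ 2 ≤ 1 := (sq_le_one_iff_abs_le_one _).2 h1
  linarith

theorem abs_cos_le_exp_neg_sq {x : ℝ} (hx : |x| ≤ 1) :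
    |Real.cos x| ≤ Real.exp (-(x ^ 2 / 5)) := by
  have hpi := Real.pi_gt_three
  have hpi' := Real.pi_lt_d2
  rw [abs_of_nonneg (Real.cos_nonneg_of_mem_Icc ⟨by linarith [(abs_le.1 hx).1],
    by linarith [(abs_le.1 hx).2]⟩)]
  have h1 := Real.cos_le_one_sub_mul_cos_sq (x := x) (by linarith)
  have h2 : 1 / 5 ≤ 2 / Real.pi ^ 2 := by
    rw [div_le_div_iff₀ (by norm_num) (by positivity)]; nlinarith
  have h3 := Real.add_one_le_exp (-(x ^ 2 / 5))
  nlinarith [sq_nonneg x]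

/-- Small ball estimate of Berry–Esseen type: a real Rademacher sum with many coefficients of
size at most `δ` and total variance at least `τ ^ 2` is of order `δ` with probability `O(δ / τ)`.
The remaining coefficients are arbitrary. -/
theorem IsRademacherSeq.measure_abs_sum_le_le [IsProbabilityMeasure P] (hξ : IsRademacherSeq P ξ)
    {S R : Finset ℤ} (hR : R ⊆ S) (c : ℤ → ℝ) {δ τ : ℝ} (hδ : 0 < δ) (hτ : 0 < τ)
    (hc : ∀ k ∈ R, |c k| ≤ δ) (hsum : τ ^ 2 ≤ ∑ k ∈ R, c k ^ 2) :
    P {ω | |∑ k ∈ S, c k * ξ k ω| ≤ δ} ≤ ENNReal.ofReal (8 * δ / τ) := by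
  -- The indicator of `[-1, 1]` is at most `4 K`, where `K` is the Fejér kernel, a superposition of
  -- the functions `cos (s x)` with `0 ≤ s ≤ 1`. For these `s`, each factor `cos (s c_k / δ)` of the
  -- characteristic function with `k ∈ R` has Gaussian decay.
  set X : Ω → ℝ := fun ω => (∑ k ∈ S, c k * ξ k ω) / δ with hX
  have hXm : Measurable X := by
    have := hξ.measurable
    fun_prop
  set K : ℝ → ℝ := fun x => ∫ s in (0 : ℝ)..1, (1 - s) * Real.cos (s * x) with hK
  have hprod : Integrable (Function.uncurry fun ω s => (1 - s) * Real.cos (s * X ω))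
      (P.prod (volume.restrict (Set.Ioc (0 : ℝ) 1))) := by
    refine Integrable.of_bound (C := 1) (Measurable.aestronglyMeasurable (by fun_prop)) ?_
    have h1 : ∀ᵐ q ∂(P.prod (volume.restrict (Set.Ioc (0 : ℝ) 1))), q.2 ∈ Set.Ioc (0 : ℝ) 1 :=
      Measure.quasiMeasurePreserving_snd.ae (ae_restrict_mem measurableSet_Ioc)
    filter_upwards [h1] with q hq
    simp only [Function.uncurry, norm_mul, Real.norm_eq_abs]
    refine mul_le_one₀ ?_ (abs_nonneg _) (Real.abs_cos_le_one _)
    rw [abs_of_nonneg (by linarith [hq.2])]; linarith [hq.1]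
  have hswap : ∫ ω, K (X ω) ∂P
      = ∫ s in Set.Ioc (0 : ℝ) 1, ∫ ω, (1 - s) * Real.cos (s * X ω) ∂P := by
    rw [← integral_integral_swap hprod]
    simp only [hK, intervalIntegral.integral_of_le zero_le_one]
  have hcos : ∀ s, ∫ ω, Real.cos (s * X ω) ∂P = ∏ k ∈ S, Real.cos (s * c k / δ) := fun s => by
    rw [← hξ.integral_cos_sum]
    refine integral_congr_ae (Filter.Eventually.of_forall fun ω => ?_)
    simp only [hX]
    congr 1
    rw [Finset.sum_div, Finset.mul_sum]
    exact Finset.sum_congr rfl fun k _ => by ring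
  have hbd : ∀ s ∈ Set.Ioc (0 : ℝ) 1, ∫ ω, (1 - s) * Real.cos (s * X ω) ∂P
      ≤ Real.exp (-(τ ^ 2 / (5 * δ ^ 2)) * s ^ 2) := fun s hs => by
    rw [integral_const_mul, hcos]
    have h1 : ∏ k ∈ S, Real.cos (s * c k / δ) ≤ ∏ k ∈ R, |Real.cos (s * c k / δ)| := by
      refine (le_abs_self _).trans ?_
      rw [Finset.abs_prod, ← Finset.prod_sdiff hR]
      exact mul_le_of_le_one_left (Finset.prod_nonneg fun _ _ => abs_nonneg _)
        (Finset.prod_le_one (fun _ _ => abs_nonneg _) fun _ _ => Real.abs_cos_le_one _)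
    have h2 : ∏ k ∈ R, |Real.cos (s * c k / δ)|
        ≤ ∏ k ∈ R, Real.exp (-((s * c k / δ) ^ 2 / 5)) := by
      refine Finset.prod_le_prod (fun _ _ => abs_nonneg _) fun k hk => abs_cos_le_exp_neg_sq ?_
      rw [abs_div, abs_mul, abs_of_pos hδ, abs_of_pos hs.1, div_le_one hδ]
      exact (mul_le_of_le_one_left (abs_nonneg _) hs.2).trans (hc k hk)
    rw [← Real.exp_sum] at h2
    have h3 : ∑ k ∈ R, -((s * c k / δ) ^ 2 / 5) ≤ -(τ ^ 2 / (5 * δ ^ 2)) * s ^ 2 := by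
      have : ∑ k ∈ R, -((s * c k / δ) ^ 2 / 5) = -(s ^ 2 / (5 * δ ^ 2)) * ∑ k ∈ R, c k ^ 2 := by
        rw [Finset.mul_sum]
        exact Finset.sum_congr rfl fun k _ => by field_simp
      rw [this]
      have h4 : 0 ≤ s ^ 2 / (5 * δ ^ 2) := by positivity
      have h5 := mul_le_mul_of_nonneg_left hsum h4
      have h6 : -(τ ^ 2 / (5 * δ ^ 2)) * s ^ 2 = -(s ^ 2 / (5 * δ ^ 2) * τ ^ 2) := by ring
      rw [h6]; linarith
    have h4 := (h1.trans h2).trans (Real.exp_le_exp.2 h3)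
    calc _ ≤ (1 - s) * Real.exp (-(τ ^ 2 / (5 * δ ^ 2)) * s ^ 2) :=
          mul_le_mul_of_nonneg_left h4 (by linarith [hs.2])
      _ ≤ _ := mul_le_of_le_one_left (Real.exp_pos _).le (by linarith [hs.1])
  have hb : 0 < τ ^ 2 / (5 * δ ^ 2) := by positivity
  have hEK : ∫ ω, K (X ω) ∂P ≤ 2 * δ / τ := by
    rw [hswap]
    calc _ ≤ ∫ s in Set.Ioc (0 : ℝ) 1, Real.exp (-(τ ^ 2 / (5 * δ ^ 2)) * s ^ 2) :=
          setIntegral_mono_on hprod.integral_prod_right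
            (integrable_exp_neg_mul_sq hb).integrableOn measurableSet_Ioc hbd
      _ ≤ ∫ s in Set.Ioi (0 : ℝ), Real.exp (-(τ ^ 2 / (5 * δ ^ 2)) * s ^ 2) :=
          setIntegral_mono_set (integrable_exp_neg_mul_sq hb).integrableOn
            (Filter.Eventually.of_forall fun _ => (Real.exp_pos _).le)
            (Set.Ioc_subset_Ioi_self.eventuallyLE)
      _ = √(Real.pi / (τ ^ 2 / (5 * δ ^ 2))) / 2 := integral_gaussian_Ioi _
      _ ≤ 2 * δ / τ := by
          rw [div_le_iff₀ two_pos]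
          refine Real.sqrt_le_iff.2 ⟨by positivity, ?_⟩
          have : Real.pi / (τ ^ 2 / (5 * δ ^ 2)) = (5 * Real.pi) * (δ / τ) ^ 2 := by field_simp
          rw [this, show (2 * δ / τ * 2) ^ 2 = 16 * (δ / τ) ^ 2 by ring]
          exact mul_le_mul_of_nonneg_right (by linarith [Real.pi_lt_d2]) (sq_nonneg _)
  have hKint : Integrable (fun ω => K (X ω)) P := by
    simp only [hK, intervalIntegral.integral_of_le zero_le_one]
    exact hprod.integral_prod_left
  have hM := mul_meas_ge_le_integral_of_nonneg (μ := P) (f := fun ω => K (X ω))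
    (Filter.Eventually.of_forall fun ω => integral_one_sub_mul_cos_nonneg _) hKint (1 / 4)
  have hreal : P.real {ω | |∑ k ∈ S, c k * ξ k ω| ≤ δ} ≤ 8 * δ / τ := by
    have h1 : P.real {ω | |∑ k ∈ S, c k * ξ k ω| ≤ δ} ≤ P.real {ω | 1 / 4 ≤ K (X ω)} := by
      refine measureReal_mono fun ω hω => quarter_le_integral_one_sub_mul_cos ?_
      simp only [hX]
      rw [abs_div, abs_of_pos hδ, div_le_one hδ]
      exact hω
    have h2 : 8 * δ / τ = 4 * (2 * δ / τ) := by ring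
    rw [h2]; linarith
  rw [← ENNReal.ofReal_toReal (measure_ne_top P _)]
  exact ENNReal.ofReal_le_ofReal hreal

end RademacherSums

/-! ### Small balls centred at the origin -/

theorem setOf_lt_subset_setOf_lt {α : Type*} {g : α → ℝ} {s t : ℝ} (h : s ≤ t) :
    {x | g x < s} ⊆ {x | g x < t} :=
  fun x hx => lt_of_lt_of_le (show g x < s from hx) h

theorem integral_fourier {n : ℤ} (hn : n ≠ 0) : ∫ θ : UnitAddCircle, fourier n θ = 0 := by
  have h : ∀ θ : UnitAddCircle, fourier n (θ + ((1 / 2 / n : ℝ) : UnitAddCircle)) = -fourier n θ :=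
    fun θ => fourier_add_half_inv_index hn one_pos θ
  exact integral_eq_zero_of_add_right_eq_neg h

/-- Parseval's identity for exponential sums. -/
theorem integral_norm_trigSum_sq (S : Finset ℤ) (c : ℤ → ℂ) :
    ∫ θ : UnitAddCircle, ‖trigSum S c θ‖ ^ 2 = ∑ k ∈ S, ‖c k‖ ^ 2 := by
  have h : ∀ θ, ((‖trigSum S c θ‖ ^ 2 : ℝ) : ℂ)
      = ∑ j ∈ S, ∑ k ∈ S, c j * starRingEnd ℂ (c k) * fourier (j - k) θ := fun θ => by
    rw [← Complex.normSq_eq_norm_sq, ← Complex.mul_conj, trigSum, map_sum, Finset.sum_mul_sum]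
    refine Finset.sum_congr rfl fun j _ => Finset.sum_congr rfl fun k _ => ?_
    rw [map_mul, ← fourier_neg, sub_eq_add_neg, fourier_add]; ring
  have hint : ∀ j k : ℤ, Integrable fun θ : UnitAddCircle =>
      c j * starRingEnd ℂ (c k) * fourier (j - k) θ := fun j k =>
    (by fun_prop : Continuous _).integrable_of_hasCompactSupport
      (HasCompactSupport.of_compactSpace _)
  have h1 : ((∫ θ : UnitAddCircle, ‖trigSum S c θ‖ ^ 2 : ℝ) : ℂ)
      = ((∑ k ∈ S, ‖c k‖ ^ 2 : ℝ) : ℂ) := by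
    rw [← integral_complex_ofReal, integral_congr_ae (Filter.Eventually.of_forall h),
      integral_finsetSum _ fun j _ => integrable_finsetSum _ fun k _ => hint j k]
    push_cast
    refine Finset.sum_congr rfl fun j hj => ?_
    rw [integral_finsetSum _ fun k _ => hint j k, Finset.sum_eq_single j]
    · rw [integral_const_mul]
      simp [Complex.mul_conj, Complex.normSq_eq_norm_sq]
    · intro k _ hk
      rw [integral_const_mul, integral_fourier (sub_ne_zero.2 hk.symm), mul_zero]
    · exact fun h => absurd hj h
  exact_mod_cast h1

/-- The Turán type lemma with the parameters that the union bound below calls for. -/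
theorem volume_norm_trigSum_lt_le_pow {n : ℕ} {S : Finset ℤ} (hS : S.card ≤ n) (c : ℤ → ℂ)
    {k₀ : ℤ} (hk : k₀ ∈ S) :
    volume {θ | ‖trigSum S c θ‖ < ‖c k₀‖ * (1 / 2) ^ (13 * n ^ 2)}
      ≤ ENNReal.ofReal ((1 / 8) ^ n) := by
  obtain ⟨m, hm⟩ : ∃ m, S.card = m + 1 := Nat.exists_eq_succ_of_ne_zero
    (Finset.card_pos.2 ⟨k₀, hk⟩).ne'
  -- With this value of the parameter, `2 √2 / √t = 16 ^ (-n)`.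
  set t : ℝ := 8 * 256 ^ n with ht
  have ht0 : 0 < t := by positivity
  have hst : √t = 2 * √2 * 16 ^ n := by
    rw [Real.sqrt_eq_iff_mul_self_eq ht0.le (by positivity)]
    have h2 : √2 * √2 = (2 : ℝ) := Real.mul_self_sqrt (by norm_num)
    have h3 : (16 : ℝ) ^ n * 16 ^ n = 256 ^ n := by
      rw [← mul_pow]; norm_num
    rw [ht]; linear_combination (-4 * ((16 : ℝ) ^ n * 16 ^ n)) * h2 - 8 * h3
  have hbase : 2 * (2 + t) ≤ 2 ^ (13 * n) := by
    have h1 : (1 : ℝ) ≤ 256 ^ n := one_le_pow₀ (by norm_num)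
    have h2 : (2 : ℝ) ^ (13 * n) = 32 ^ n * 256 ^ n := by
      rw [pow_mul, ← mul_pow]; norm_num
    have h3 : (32 : ℝ) ≤ 32 ^ n := le_self_pow₀ (by norm_num) (by omega)
    rw [h2, ht]; nlinarith
  have hpow : (2 * (2 + t)) ^ m ≤ 2 ^ (13 * n ^ 2) := by
    have h1 : (1 : ℝ) ≤ 2 * (2 + t) := by linarith
    calc _ ≤ (2 * (2 + t)) ^ n := pow_le_pow_right₀ h1 (by omega)
      _ ≤ (2 ^ (13 * n)) ^ n := pow_le_pow_left₀ (by linarith) hbase n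
      _ = _ := by rw [← pow_mul]; ring_nf
  refine (measure_mono (setOf_lt_subset_setOf_lt ?_)).trans
    ((volume_norm_trigSum_lt_le ht0 m S c k₀ hk hm).trans ?_)
  · rw [div_eq_mul_inv (‖c k₀‖), one_div, inv_pow]
    refine mul_le_mul_of_nonneg_left ?_ (norm_nonneg _)
    exact inv_anti₀ (by positivity) hpow
  · rw [← ENNReal.ofReal_natCast, ← ENNReal.ofReal_mul (Nat.cast_nonneg _), hst]
    refine ENNReal.ofReal_le_ofReal ?_
    have h1 : (m : ℝ) ≤ 2 ^ n := by
      have : m ≤ 2 ^ n := by have := @Nat.lt_two_pow_self n; omega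
      exact_mod_cast this
    have h2 : 2 * √2 / (2 * √2 * 16 ^ n) = ((1 : ℝ) / 16) ^ n := by
      rw [one_div, inv_pow]; field_simp
    have h3 : ((1 : ℝ) / 8) ^ n = 2 ^ n * (1 / 16) ^ n := by rw [← mul_pow]; norm_num
    rw [h2, h3]
    exact mul_le_mul_of_nonneg_right h1 (by positivity)

/-- The finite Rademacher Fourier series `∑_{k ∈ S} a_k ξ_k(ω) e^{2πikθ}`. -/
noncomputable def radSum {Ω : Type*} (ξ : ℤ → Ω → ℝ) (S : Finset ℤ) (a : ℤ → ℂ)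
    (q : Ω × UnitAddCircle) : ℂ :=
  ∑ k ∈ S, (ξ k q.1 : ℂ) * (a k * fourier k q.2)

theorem radSum_eq_trigSum {Ω : Type*} (ξ : ℤ → Ω → ℝ) (S : Finset ℤ) (a : ℤ → ℂ)
    (q : Ω × UnitAddCircle) :
    radSum ξ S a q = trigSum S (fun k => (ξ k q.1 : ℂ) * a k) q.2 := by
  simp only [radSum, trigSum, mul_assoc]

section Measurability

variable {Ω : Type*} [MeasurableSpace Ω] {P : Measure Ω} {ξ : ℤ → Ω → ℝ}

theorem IsRademacherSeq.measurable_radSum (hξ : IsRademacherSeq P ξ) (S : Finset ℤ) (a : ℤ → ℂ) :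
    Measurable (radSum ξ S a) := by
  unfold radSum
  refine Finset.measurable_sum _ fun k _ => ?_
  have h1 := hξ.measurable k
  have h2 : Measurable fun q : Ω × UnitAddCircle => fourier k q.2 :=
    (fourier k).continuous.measurable.comp measurable_snd
  fun_prop

theorem IsRademacherSeq.norm_sign_mul (hξ : IsRademacherSeq P ξ) (k : ℤ) (ω : Ω) (z : ℂ) :
    ‖(ξ k ω : ℂ) * z‖ = ‖z‖ := by
  rw [norm_mul, Complex.norm_real, Real.norm_eq_abs, hξ.abs_eq_one, one_mul]

end Measurability

theorem measure_prod_le_add_of_forall_snd {α β : Type*} [MeasurableSpace α] [MeasurableSpace β]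
    {μ : Measure α} {ν : Measure β} [IsProbabilityMeasure μ] [IsProbabilityMeasure ν]
    {A : Set (α × β)} (hA : MeasurableSet A) {B : Set β} {ε : ℝ≥0∞}
    (h : ∀ y ∉ B, μ {x | (x, y) ∈ A} ≤ ε) : μ.prod ν A ≤ ε + ν B := by
  rw [Measure.prod_apply_symm hA]
  calc _ ≤ ∫⁻ y, (ε + B.indicator 1 y) ∂ν := by
        refine lintegral_mono fun y => ?_
        by_cases hy : y ∈ B
        · simp only [Set.indicator_of_mem hy, Pi.one_apply]
          exact prob_le_one.trans le_add_self
        · exact (h y hy).trans le_self_add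
    _ = ε + ∫⁻ y, B.indicator 1 y ∂ν := by
        rw [lintegral_add_left measurable_const]; simp
    _ ≤ _ := by gcongr; exact lintegral_indicator_one_le B

section MeasureQ

variable {Ω : Type*} [MeasurableSpace Ω] {P : Measure Ω} [IsProbabilityMeasure P]

theorem measureQ_le_of_forall_fst {A : Set (Ω × UnitAddCircle)} (hA : MeasurableSet A) {ε : ℝ≥0∞}
    (h : ∀ ω, volume {θ | (ω, θ) ∈ A} ≤ ε) : measureQ P A ≤ ε := by
  rw [measureQ, Measure.prod_apply hA]
  exact (lintegral_mono h).trans (by simp)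

variable {ξ : ℤ → Ω → ℝ}

theorem IsRademacherSeq.lintegral_radSum_sq (hξ : IsRademacherSeq P ξ) (S : Finset ℤ)
    (a : ℤ → ℂ) :
    ∫⁻ q, ENNReal.ofReal (‖radSum ξ S a q‖ ^ 2) ∂(measureQ P)
      = ENNReal.ofReal (∑ k ∈ S, ‖a k‖ ^ 2) := by
  have hm := hξ.measurable_radSum S a
  rw [measureQ, lintegral_prod _ (by fun_prop)]
  have h : ∀ ω, ∫⁻ θ : UnitAddCircle, ENNReal.ofReal (‖radSum ξ S a (ω, θ)‖ ^ 2)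
      = ENNReal.ofReal (∑ k ∈ S, ‖a k‖ ^ 2) := fun ω => by
    simp only [radSum_eq_trigSum]
    rw [← ofReal_integral_eq_lintegral_ofReal, integral_norm_trigSum_sq]
    · simp only [hξ.norm_sign_mul]
    · exact (((continuous_trigSum _ _).norm.pow 2)).integrable_of_hasCompactSupport
        (HasCompactSupport.of_compactSpace _)
    · exact Filter.Eventually.of_forall fun _ => sq_nonneg _
  rw [lintegral_congr h]
  simp

theorem IsRademacherSeq.measureQ_le_norm_radSum_le (hξ : IsRademacherSeq P ξ) (S : Finset ℤ)
    (a : ℤ → ℂ) {s : ℝ} (hs : 0 < s) :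
    measureQ P {q | s ≤ ‖radSum ξ S a q‖} ≤ ENNReal.ofReal ((∑ k ∈ S, ‖a k‖ ^ 2) / s ^ 2) := by
  have hm := hξ.measurable_radSum S a
  have h := meas_ge_le_lintegral_div (μ := measureQ P)
    (f := fun q => ENNReal.ofReal (‖radSum ξ S a q‖ ^ 2)) (by fun_prop)
    (ε := ENNReal.ofReal (s ^ 2)) (ENNReal.ofReal_pos.2 (by positivity)).ne' ENNReal.ofReal_ne_top
  rw [hξ.lintegral_radSum_sq, ← ENNReal.ofReal_div_of_pos (by positivity)] at h
  refine (measure_mono fun q hq => ?_).trans h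
  exact ENNReal.ofReal_le_ofReal (pow_le_pow_left₀ hs.le hq 2)

/-- Small ball estimate when at least `n` coefficients are large compared to the radius. By the
Turán type lemma, for most `θ` the signed sums over these `n` coefficients are separated. -/
theorem IsRademacherSeq.measureQ_norm_radSum_lt_le_of_large (hξ : IsRademacherSeq P ξ)
    {S T : Finset ℤ} (hTS : T ⊆ S) (a : ℤ → ℂ) {δ : ℝ} (hT : ∀ k ∈ T, δ ≤ ‖a k‖) :
    measureQ P {q | ‖radSum ξ S a q‖ < δ * (1 / 2) ^ (13 * T.card ^ 2)}
      ≤ ENNReal.ofReal (2 * (1 / 2) ^ T.card) := by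
  set n := T.card with hn
  set r : ℝ := (1 / 2) ^ (13 * n ^ 2) with hr
  have hr0 : 0 < r := by positivity
  set I := (T.powerset ×ˢ T.powerset).filter fun p => p.1 ≠ p.2 with hI
  set c : Finset ℤ × Finset ℤ → ℤ → ℂ := fun p k =>
    ((signOf p.1 k - signOf p.2 k : ℝ) : ℂ) * a k with hc
  set B : Set UnitAddCircle := ⋃ p ∈ I, {θ | ‖trigSum T (c p) θ‖ < 2 * (δ * r)} with hB
  have hBp : ∀ p ∈ I, volume {θ | ‖trigSum T (c p) θ‖ < 2 * (δ * r)}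
      ≤ ENNReal.ofReal ((1 / 8) ^ n) := by
    intro p hp
    simp only [hI, Finset.mem_filter, Finset.mem_product, Finset.mem_powerset] at hp
    obtain ⟨⟨hU, hV⟩, hne⟩ := hp
    obtain ⟨k, hk⟩ : ∃ k, ¬ (k ∈ p.1 ↔ k ∈ p.2) := by
      by_contra hcon; push Not at hcon; exact hne (Finset.ext hcon)
    have hkT : k ∈ T := by
      by_cases h : k ∈ p.1
      · exact hU h
      · exact hV (by tauto)
    have hck : ‖c p k‖ = 2 * ‖a k‖ := by
      simp only [hc]
      rw [norm_mul, Complex.norm_real]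
      congr 1
      unfold signOf
      split_ifs <;> first | tauto | norm_num
    refine (measure_mono (setOf_lt_subset_setOf_lt ?_)).trans
      (volume_norm_trigSum_lt_le_pow (le_of_eq hn.symm) (c p) hkT)
    rw [hck, ← mul_assoc]
    exact mul_le_mul_of_nonneg_right (by linarith [hT k hkT]) hr0.le
  have hBvol : volume B ≤ ENNReal.ofReal ((1 / 2) ^ n) := by
    refine (measure_biUnion_finset_le I _).trans ((Finset.sum_le_sum hBp).trans ?_)
    rw [Finset.sum_const, nsmul_eq_mul, ← ENNReal.ofReal_natCast,
      ← ENNReal.ofReal_mul (Nat.cast_nonneg _)]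
    refine ENNReal.ofReal_le_ofReal ?_
    have h1 : (I.card : ℝ) ≤ 4 ^ n := by
      have : I.card ≤ 4 ^ n := by
        refine (Finset.card_filter_le _ _).trans (le_of_eq ?_)
        rw [Finset.card_product, Finset.card_powerset, ← hn, ← mul_pow]
        norm_num
      exact_mod_cast this
    have h2 : ((1 : ℝ) / 2) ^ n = 4 ^ n * (1 / 8) ^ n := by rw [← mul_pow]; norm_num
    rw [h2]
    exact mul_le_mul_of_nonneg_right h1 (by positivity)
  have hA : MeasurableSet {q | ‖radSum ξ S a q‖ < δ * r} :=
    measurableSet_lt (hξ.measurable_radSum S a).norm measurable_const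
  refine (measure_prod_le_add_of_forall_snd hA (B := B) (ε := ENNReal.ofReal ((1 / 2) ^ n))
    fun θ hθ => ?_).trans ?_
  · have h1 := hξ.measure_norm_sum_lt_le hTS (fun k => a k * fourier k θ) (δ := δ * r) ?_
    · refine h1.trans (le_of_eq ?_)
      rw [ENNReal.ofReal_pow (by norm_num), ENNReal.ofReal_div_of_pos two_pos]
      simp [hn]
    · intro U hU V hV hUV
      by_contra hcon
      have hUV' : (U, V) ∈ I := by
        simp [hI, hUV, Finset.mem_powerset.1 hU, Finset.mem_powerset.1 hV]
      refine hθ (Set.mem_iUnion₂.2 ⟨(U, V), hUV', ?_⟩)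
      simp only [Set.mem_ofPred_eq, trigSum, hc, mul_assoc]
      simpa only [not_le] using hcon
  · refine (add_le_add_right hBvol _).trans (le_of_eq ?_)
    rw [← ENNReal.ofReal_add (by positivity) (by positivity)]
    congr 1; ring

/-- Small ball estimate in terms of the variance of the small coefficients. -/
theorem IsRademacherSeq.measureQ_norm_radSum_lt_le_of_small (hξ : IsRademacherSeq P ξ)
    {S R : Finset ℤ} (hRS : R ⊆ S) (a : ℤ → ℂ) {δ τ : ℝ} (hδ : 0 < δ) (hτ : 0 < τ)
    (hR : ∀ k ∈ R, ‖a k‖ ≤ δ) (hsum : τ ^ 2 ≤ ∑ k ∈ R, ‖a k‖ ^ 2) :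
    measureQ P {q | ‖radSum ξ S a q‖ < δ} ≤ ENNReal.ofReal (16 * δ / τ) := by
  have hA : MeasurableSet {q | ‖radSum ξ S a q‖ < δ} :=
    measurableSet_lt (hξ.measurable_radSum S a).norm measurable_const
  refine (measure_prod_le_add_of_forall_snd hA (B := ∅) (ε := ENNReal.ofReal (16 * δ / τ))
    fun θ _ => ?_).trans (by simp)
  set z : ℤ → ℂ := fun k => a k * fourier k θ with hz
  have hzn : ∀ k, ‖z k‖ = ‖a k‖ := fun k => by
    rw [hz]; simp only [norm_mul, norm_fourier_apply, mul_one]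
  -- One of the real and the imaginary part of the sum carries half of the variance.
  have hsplit : ∑ k ∈ R, ‖a k‖ ^ 2 = ∑ k ∈ R, (z k).re ^ 2 + ∑ k ∈ R, (z k).im ^ 2 := by
    rw [← Finset.sum_add_distrib]
    refine Finset.sum_congr rfl fun k _ => ?_
    rw [← hzn, ← Complex.normSq_eq_norm_sq, Complex.normSq_apply]; ring
  have hre : ∀ ω, (radSum ξ S a (ω, θ)).re = ∑ k ∈ S, (z k).re * ξ k ω := fun ω => by
    simp only [radSum, Complex.re_sum, Complex.re_ofReal_mul, hz, mul_comm]
  have him : ∀ ω, (radSum ξ S a (ω, θ)).im = ∑ k ∈ S, (z k).im * ξ k ω := fun ω => by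
    simp only [radSum, Complex.im_sum, Complex.im_ofReal_mul, hz, mul_comm]
  have hval : 8 * δ / (τ / 2) = 16 * δ / τ := by field_simp; ring
  rw [← hval]
  rcases le_total (∑ k ∈ R, (z k).im ^ 2) (∑ k ∈ R, (z k).re ^ 2) with h | h
  · refine (measure_mono fun ω hω => ?_).trans
      (hξ.measure_abs_sum_le_le hRS (fun k => (z k).re) hδ (half_pos hτ)
        (fun k hk => ((Complex.abs_re_le_norm _).trans_eq (hzn k)).trans (hR k hk)) ?_)
    · change |_| ≤ δ
      rw [← hre]
      exact (Complex.abs_re_le_norm _).trans (le_of_lt hω)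
    · nlinarith
  · refine (measure_mono fun ω hω => ?_).trans
      (hξ.measure_abs_sum_le_le hRS (fun k => (z k).im) hδ (half_pos hτ)
        (fun k hk => ((Complex.abs_im_le_norm _).trans_eq (hzn k)).trans (hR k hk)) ?_)
    · change |_| ≤ δ
      rw [← him]
      exact (Complex.abs_im_le_norm _).trans (le_of_lt hω)
    · nlinarith

/-- Small ball estimate when fewer than `n` coefficients carry most of the variance. -/
theorem IsRademacherSeq.measureQ_norm_radSum_lt_le_of_few (hξ : IsRademacherSeq P ξ)
    {S T : Finset ℤ} (hTS : T ⊆ S) (a : ℤ → ℂ) {n : ℕ} (hn : 0 < n) (hT : T.card ≤ n)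
    (hnorm : 1 ≤ ∑ k ∈ S, ‖a k‖ ^ 2)
    (htail : ∑ k ∈ S \ T, ‖a k‖ ^ 2 ≤ ((1 / 2) ^ (2 * n + 1) * (1 / 2) ^ (13 * n ^ 2)) ^ 2) :
    measureQ P {q | ‖radSum ξ S a q‖ < (1 / 2) ^ (n + 1) * (1 / 2) ^ (13 * n ^ 2)}
      ≤ ENNReal.ofReal (2 * (1 / 2) ^ n) := by
  set r : ℝ := (1 / 2) ^ (13 * n ^ 2) with hr
  have hr0 : 0 < r := by positivity
  have hr1 : r ≤ 1 := pow_le_one₀ (by norm_num) (by norm_num)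
  have htail' : ∑ k ∈ S \ T, ‖a k‖ ^ 2 ≤ 1 / 4 := by
    refine htail.trans ?_
    have h1 : ((1 : ℝ) / 2) ^ (2 * n + 1) ≤ 1 / 2 := by
      rw [pow_succ]
      exact mul_le_of_le_one_left (by norm_num) (pow_le_one₀ (by norm_num) (by norm_num))
    have h2 : ((1 : ℝ) / 2) ^ (2 * n + 1) * r ≤ 1 / 2 :=
      (mul_le_of_le_one_right (by positivity) hr1).trans h1
    have h3 : 0 ≤ ((1 : ℝ) / 2) ^ (2 * n + 1) * r := by positivity
    nlinarith
  obtain ⟨k₀, hk₀, hak₀⟩ : ∃ k₀ ∈ T, ((1 : ℝ) / 2) ^ n ≤ ‖a k₀‖ := by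
    by_contra hcon
    push Not at hcon
    have h1 : ∑ k ∈ T, ‖a k‖ ^ 2 ≤ T.card • (((1 : ℝ) / 2) ^ n) ^ 2 :=
      Finset.sum_le_card_nsmul _ _ _ fun k hk =>
        pow_le_pow_left₀ (norm_nonneg _) (hcon k hk).le 2
    have h2 := Finset.sum_sdiff (f := fun k => ‖a k‖ ^ 2) hTS
    have h3 : (T.card : ℝ) ≤ 2 ^ n / 2 := by
      have h4 : T.card ≤ 2 ^ (n - 1) := by
        have := @Nat.lt_two_pow_self (n - 1); omega
      have h5 : (2 : ℝ) ^ n = 2 ^ (n - 1) * 2 := by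
        rw [← pow_succ]; congr 1; omega
      rw [h5, mul_div_cancel_right₀ _ two_ne_zero]
      exact_mod_cast h4
    rw [nsmul_eq_mul] at h1
    have h6 : (2 : ℝ) ^ n * (1 / 2) ^ n = 1 := by rw [← mul_pow]; norm_num
    have h7 : ((1 : ℝ) / 2) ^ n ≤ 1 := pow_le_one₀ (by norm_num) (by norm_num)
    have h8 : (0 : ℝ) < (1 / 2) ^ n := by positivity
    have h9 := mul_le_mul_of_nonneg_right h3 (sq_nonneg (((1 : ℝ) / 2) ^ n))
    nlinarith
  set s : ℝ := (1 / 2) ^ (n + 1) * r with hs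
  have hs0 : 0 < s := by positivity
  have hmain : measureQ P {q | ‖radSum ξ T a q‖ < (1 / 2) ^ n * r}
      ≤ ENNReal.ofReal ((1 / 2) ^ n) := by
    refine measureQ_le_of_forall_fst
      (measurableSet_lt (hξ.measurable_radSum T a).norm measurable_const) fun ω => ?_
    refine (measure_mono fun θ hθ => ?_).trans ((volume_norm_trigSum_lt_le_pow hT
      (fun k => (ξ k ω : ℂ) * a k) hk₀).trans (ENNReal.ofReal_le_ofReal ?_))
    · simp only [Set.mem_ofPred_eq, radSum_eq_trigSum] at hθ
      simp only [Set.mem_ofPred_eq, hξ.norm_sign_mul]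
      exact hθ.trans_le (mul_le_mul_of_nonneg_right hak₀ hr0.le)
    · exact pow_le_pow_left₀ (by norm_num) (by norm_num) n
  have hrem : measureQ P {q | s ≤ ‖radSum ξ (S \ T) a q‖} ≤ ENNReal.ofReal ((1 / 2) ^ n) := by
    refine (hξ.measureQ_le_norm_radSum_le _ a hs0).trans (ENNReal.ofReal_le_ofReal ?_)
    rw [div_le_iff₀ (by positivity)]
    refine htail.trans ?_
    have h1 : (((1 : ℝ) / 2) ^ (2 * n + 1) * r) ^ 2 = ((1 / 2) ^ n) ^ 2 * s ^ 2 := by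
      rw [hs]; ring
    rw [h1]
    refine mul_le_mul_of_nonneg_right ?_ (sq_nonneg _)
    exact pow_le_of_le_one (by positivity) (pow_le_one₀ (by norm_num) (by norm_num)) two_ne_zero
  refine (measure_mono (t := {q | ‖radSum ξ T a q‖ < (1 / 2) ^ n * r} ∪
    {q | s ≤ ‖radSum ξ (S \ T) a q‖}) fun q hq => ?_).trans
    ((measure_union_le _ _).trans ((add_le_add hmain hrem).trans (le_of_eq ?_)))
  · by_contra hcon
    simp only [Set.mem_union, Set.mem_ofPred_eq, not_or, not_lt, not_le] at hcon hq
    have h1 : radSum ξ S a q = radSum ξ T a q + radSum ξ (S \ T) a q := by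
      simp only [radSum]; rw [add_comm, Finset.sum_sdiff hTS]
    have h2 : ‖radSum ξ T a q‖ ≤ ‖radSum ξ S a q‖ + ‖radSum ξ (S \ T) a q‖ := by
      have h3 : radSum ξ T a q = radSum ξ S a q - radSum ξ (S \ T) a q := by rw [h1]; ring
      rw [h3]; exact norm_sub_le _ _
    have h4 : ((1 : ℝ) / 2) ^ n * r = s + s := by rw [hs]; ring
    linarith [hcon.1, hcon.2]
  · rw [← ENNReal.ofReal_add (by positivity) (by positivity)]
    congr 1; ring

/-- Small ball estimate for finite Rademacher Fourier series, at the origin. -/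
theorem IsRademacherSeq.measureQ_norm_radSum_lt_le (hξ : IsRademacherSeq P ξ)
    (S : Finset ℤ) (a : ℤ → ℂ) (hnorm : 1 ≤ ∑ k ∈ S, ‖a k‖ ^ 2) {n : ℕ} (hn : 0 < n) :
    measureQ P {q | ‖radSum ξ S a q‖ < (1 / 2) ^ (34 * n ^ 2)}
      ≤ ENNReal.ofReal (2 * (1 / 2) ^ n) := by
  have hpow : ∀ {i j : ℕ}, i ≤ j → ((1 : ℝ) / 2) ^ j ≤ (1 / 2) ^ i := fun h =>
    pow_le_pow_of_le_one (by norm_num) (by norm_num) h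
  have hnn : n ≤ n ^ 2 := Nat.le_self_pow two_ne_zero n
  -- The threshold that separates large from small coefficients.
  set δ : ℝ := (1 / 2) ^ (3 * n + 5 + 13 * n ^ 2) with hδ
  set T := S.filter fun k => δ ≤ ‖a k‖ with hT
  rcases le_or_gt n T.card with hcard | hcard
  · obtain ⟨T', hT'T, hT'⟩ := Finset.exists_subset_card_eq hcard
    have h := hξ.measureQ_norm_radSum_lt_le_of_large (hT'T.trans (Finset.filter_subset _ _)) a
      (δ := δ) fun k hk => (Finset.mem_filter.1 (hT'T hk)).2
    rw [hT'] at h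
    refine (measure_mono (setOf_lt_subset_setOf_lt ?_)).trans h
    rw [hδ, ← pow_add]
    exact hpow (by omega)
  · rcases le_or_gt (∑ k ∈ S \ T, ‖a k‖ ^ 2)
      (((1 / 2) ^ (2 * n + 1) * (1 / 2) ^ (13 * n ^ 2)) ^ 2) with htail | htail
    · refine (measure_mono (setOf_lt_subset_setOf_lt ?_)).trans
        (hξ.measureQ_norm_radSum_lt_le_of_few (Finset.filter_subset _ _) a hn hcard.le hnorm htail)
      rw [← pow_add]
      exact hpow (by omega)
    · have h := hξ.measureQ_norm_radSum_lt_le_of_small (S := S) (R := S \ T) Finset.sdiff_subset a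
        (δ := δ) (by positivity) (by positivity) (fun k hk => ?_) htail.le
      · refine (measure_mono (setOf_lt_subset_setOf_lt (hpow (by omega)))).trans
          (h.trans (ENNReal.ofReal_le_ofReal ?_))
        rw [div_le_iff₀ (by positivity), hδ]
        have : ((1 : ℝ) / 2) ^ (3 * n + 5 + 13 * n ^ 2) * 16
            = (1 / 2) ^ n * ((1 / 2) ^ (2 * n + 1) * (1 / 2) ^ (13 * n ^ 2)) := by ring
        have h0 : (0 : ℝ) < (1 / 2) ^ n * ((1 / 2) ^ (2 * n + 1) * (1 / 2) ^ (13 * n ^ 2)) := by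
          positivity
        linarith
      · simp only [hT, Finset.mem_sdiff, Finset.mem_filter, not_and, not_le] at hk
        exact (hk.2 hk.1).le

end MeasureQ

/-! ### Small balls centred at a function of `ω` -/

theorem volume_norm_fourier_sub_one_lt_le {k : ℤ} (hk : k ≠ 0) {m : ℕ} (hm : 2 ≤ m) :
    volume {t : UnitAddCircle | ‖(fourier k t : ℂ) - 1‖ < (1 / 2) ^ (13 * m ^ 2)}
      ≤ ENNReal.ofReal ((1 / 8) ^ m) := by
  have h := volume_norm_trigSum_lt_le_pow (S := {k, 0}) ((Finset.card_le_two).trans hm)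
    (fun j => if j = k then 1 else -1) (k₀ := k) (by simp)
  simpa [trigSum, Finset.sum_pair hk, hk.symm, sub_eq_add_neg] using h

/-- For most translations `t`, passing from `∑ c_k e^{2πikθ}` to its difference by `t` does not
decrease the `L²` norm of the nonconstant part too much. -/
theorem volume_sum_mul_norm_fourier_sub_one_lt_le {S : Finset ℤ} (hS : 0 ∉ S) {w : ℤ → ℝ}
    (hw : ∀ k, 0 ≤ w k) (hpos : 0 < ∑ k ∈ S, w k) {m : ℕ} (hm : 2 ≤ m) :
    volume {t : UnitAddCircle | ∑ k ∈ S, w k * ‖(fourier k t : ℂ) - 1‖ ^ 2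
        < (∑ k ∈ S, w k) / 2 * ((1 / 2) ^ (13 * m ^ 2)) ^ 2}
      ≤ ENNReal.ofReal (2 * (1 / 8) ^ m) := by
  set s : ℝ := (1 / 2) ^ (13 * m ^ 2) with hs
  have hs0 : 0 < s := by positivity
  set η := ∑ k ∈ S, w k with hη
  set D : ℤ → Set UnitAddCircle := fun k => {t | ‖(fourier k t : ℂ) - 1‖ < s} with hD
  have hDm : ∀ k, MeasurableSet (D k) := fun k =>
    (isOpen_lt (by fun_prop) continuous_const).measurableSet
  -- The weighted proportion of frequencies that `t` almost annihilates.
  set Y : UnitAddCircle → ℝ≥0∞ := fun t =>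
    ∑ k ∈ S, ENNReal.ofReal (w k) * (D k).indicator 1 t with hY
  have hYm : Measurable Y := Finset.measurable_sum _ fun k _ =>
    (measurable_one.indicator (hDm k)).const_mul _
  have hYint : ∫⁻ t, Y t ≤ ENNReal.ofReal (η * (1 / 8) ^ m) := by
    rw [lintegral_finsetSum _ fun k _ => (measurable_one.indicator (hDm k)).const_mul _, hη,
      Finset.sum_mul, ENNReal.ofReal_sum_of_nonneg fun k _ => mul_nonneg (hw k) (by positivity)]
    refine Finset.sum_le_sum fun k hk => ?_
    rw [lintegral_const_mul _ (measurable_one.indicator (hDm k)), lintegral_indicator_one (hDm k),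
      ENNReal.ofReal_mul (hw k)]
    gcongr
    exact volume_norm_fourier_sub_one_lt_le (fun h => hS (h ▸ hk)) hm
  have hM := meas_ge_le_lintegral_div (μ := (volume : Measure UnitAddCircle)) hYm.aemeasurable
    (ε := ENNReal.ofReal (η / 2)) (ENNReal.ofReal_pos.2 (half_pos hpos)).ne' ENNReal.ofReal_ne_top
  refine (measure_mono fun t ht => ?_).trans
    (hM.trans ((ENNReal.div_le_div_right hYint _).trans ?_))
  · by_contra hcon
    simp only [Set.mem_ofPred_eq, not_le] at hcon ht
    have hYt : Y t = ENNReal.ofReal (∑ k ∈ S, w k * (D k).indicator (fun _ => 1) t) := by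
      rw [ENNReal.ofReal_sum_of_nonneg fun k _ => mul_nonneg (hw k)
        (Set.indicator_nonneg (fun _ _ => zero_le_one) t)]
      refine Finset.sum_congr rfl fun k _ => ?_
      rw [ENNReal.ofReal_mul (hw k)]
      by_cases h : t ∈ D k <;> simp [h]
    rw [hYt, ENNReal.ofReal_lt_ofReal_iff (half_pos hpos)] at hcon
    have h1 : (η - ∑ k ∈ S, w k * (D k).indicator (fun _ => 1) t) * s ^ 2
        ≤ ∑ k ∈ S, w k * ‖(fourier k t : ℂ) - 1‖ ^ 2 := by
      rw [hη, ← Finset.sum_sub_distrib, Finset.sum_mul]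
      refine Finset.sum_le_sum fun k _ => ?_
      by_cases h : t ∈ D k
      · rw [Set.indicator_of_mem h]
        simpa using mul_nonneg (hw k) (sq_nonneg _)
      · rw [Set.indicator_of_notMem h, mul_zero, sub_zero]
        simp only [hD, Set.mem_ofPred_eq, not_lt] at h
        exact mul_le_mul_of_nonneg_left (pow_le_pow_left₀ hs0.le h 2) (hw k)
    have h2 := mul_lt_mul_of_pos_right hcon (pow_pos hs0 2)
    linarith
  · rw [← ENNReal.ofReal_div_of_pos (half_pos hpos)]
    refine ENNReal.ofReal_le_ofReal (le_of_eq ?_)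
    field_simp

theorem ENNReal.sq_lintegral_le {α : Type*} [MeasurableSpace α] {μ : Measure α}
    [IsProbabilityMeasure μ] {φ : α → ℝ≥0∞} (hφ : Measurable φ) (h1 : ∀ x, φ x ≤ 1) :
    (∫⁻ x, φ x ∂μ) ^ 2 ≤ ∫⁻ x, φ x ^ 2 ∂μ := by
  set I := ∫⁻ x, φ x ∂μ with hI
  have hI1 : I ≤ 1 := (lintegral_mono h1).trans (by simp)
  have hItop : I ≠ ∞ := (hI1.trans_lt ENNReal.one_lt_top).ne
  -- The inequality `2 I φ ≤ φ ^ 2 + I ^ 2`, integrated; no subtraction in `ℝ≥0∞` is involved.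
  have h2 : ∀ x, 2 * I * φ x ≤ φ x ^ 2 + I ^ 2 := fun x => by
    have hx : φ x ≠ ∞ := ((h1 x).trans_lt ENNReal.one_lt_top).ne
    rw [← ENNReal.coe_toNNReal hItop, ← ENNReal.coe_toNNReal hx, mul_right_comm]
    exact_mod_cast two_mul_le_add_sq (φ x).toNNReal I.toNNReal
  have h3 := lintegral_mono (μ := μ) h2
  rw [lintegral_const_mul _ hφ, lintegral_add_right _ measurable_const, lintegral_const,
    measure_univ, mul_one, ← hI] at h3
  have h4 : 2 * I * I = I ^ 2 + I ^ 2 := by ring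
  rw [h4] at h3
  exact (ENNReal.add_le_add_iff_right (ENNReal.pow_ne_top hItop)).1 h3

theorem radSum_add_sub {Ω : Type*} (ξ : ℤ → Ω → ℝ) (S : Finset ℤ) (a : ℤ → ℂ) (ω : Ω)
    (θ t : UnitAddCircle) :
    radSum ξ S a (ω, θ + t) - radSum ξ S a (ω, θ)
      = radSum ξ (S.erase 0) (fun k => a k * ((fourier k t : ℂ) - 1)) (ω, θ) := by
  have h0 : radSum ξ (S.erase 0) (fun k => a k * ((fourier k t : ℂ) - 1)) (ω, θ)
      = radSum ξ S (fun k => a k * ((fourier k t : ℂ) - 1)) (ω, θ) := by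
    simp only [radSum]
    refine Finset.sum_erase _ ?_
    simp
  rw [h0]
  simp only [radSum, ← Finset.sum_sub_distrib]
  refine Finset.sum_congr rfl fun k _ => ?_
  have : (fourier k (θ + t) : ℂ) = fourier k θ * fourier k t := by
    simp [fourier_apply, smul_add, AddCircle.toCircle_add]
  rw [this]; ring

section Translation

variable {Ω : Type*} [MeasurableSpace Ω] {P : Measure Ω} [IsProbabilityMeasure P]

/-- A set of measure `ε` meets its own translate along the circle in measure `ε ^ 2` on average. -/
theorem sq_measureQ_le {E : Set (Ω × UnitAddCircle)} (hE : MeasurableSet E) :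
    measureQ P E ^ 2 ≤ ((measureQ P).prod (volume : Measure UnitAddCircle))
      {x | x.1 ∈ E ∧ (x.1.1, x.1.2 + x.2) ∈ E} := by
  have hF : MeasurableSet {x : (Ω × UnitAddCircle) × UnitAddCircle |
      x.1 ∈ E ∧ (x.1.1, x.1.2 + x.2) ∈ E} :=
    (measurable_fst hE).inter ((by fun_prop : Measurable
      fun x : (Ω × UnitAddCircle) × UnitAddCircle => (x.1.1, x.1.2 + x.2)) hE)
  set φ : Ω → ℝ≥0∞ := fun ω => volume {θ : UnitAddCircle | (ω, θ) ∈ E} with hφ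
  have hφm : Measurable φ := measurable_measure_prodMk_left hE
  have hslice : ∀ q : Ω × UnitAddCircle, volume (Prod.mk q ⁻¹'
      {x : (Ω × UnitAddCircle) × UnitAddCircle | x.1 ∈ E ∧ (x.1.1, x.1.2 + x.2) ∈ E})
        = E.indicator (fun q => φ q.1) q := fun q => by
    by_cases hq : q ∈ E
    · rw [Set.indicator_of_mem hq]
      have : Prod.mk q ⁻¹' {x : (Ω × UnitAddCircle) × UnitAddCircle |
          x.1 ∈ E ∧ (x.1.1, x.1.2 + x.2) ∈ E}
          = (fun t => q.2 + t) ⁻¹' {θ : UnitAddCircle | (q.1, θ) ∈ E} := by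
        ext t; simp [hq]
      rw [this, measure_preimage_add]
    · rw [Set.indicator_of_notMem hq]
      have : Prod.mk q ⁻¹' {x : (Ω × UnitAddCircle) × UnitAddCircle |
          x.1 ∈ E ∧ (x.1.1, x.1.2 + x.2) ∈ E} = ∅ := by
        ext t; simp [hq]
      rw [this, measure_empty]
  rw [Measure.prod_apply hF, lintegral_congr hslice, measureQ, Measure.prod_apply hE,
    lintegral_prod (fun q : Ω × UnitAddCircle => E.indicator (fun q => φ q.1) q)
      ((hφm.comp measurable_fst).indicator hE).aemeasurable]
  refine (ENNReal.sq_lintegral_le hφm fun ω => prob_le_one).trans (lintegral_mono fun ω => ?_)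
  have h : ∀ θ : UnitAddCircle, E.indicator (fun q => φ q.1) (ω, θ)
      = {θ : UnitAddCircle | (ω, θ) ∈ E}.indicator (fun _ => φ ω) θ := fun θ => rfl
  have hm : MeasurableSet {θ : UnitAddCircle | (ω, θ) ∈ E} := measurable_prodMk_left hE
  rw [lintegral_congr h, lintegral_indicator_const hm]
  exact (pow_two _).le

variable {ξ : ℤ → Ω → ℝ}

/-- The small ball estimate at the origin, rescaled to a variance of at least `ρ ^ 2`. -/
theorem IsRademacherSeq.measureQ_norm_radSum_lt_le_of_sq_le (hξ : IsRademacherSeq P ξ)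
    (S : Finset ℤ) (a : ℤ → ℂ) {ρ : ℝ} (hρ : 0 < ρ) (hnorm : ρ ^ 2 ≤ ∑ k ∈ S, ‖a k‖ ^ 2) {n : ℕ}
    (hn : 0 < n) :
    measureQ P {q | ‖radSum ξ S a q‖ < ρ * (1 / 2) ^ (34 * n ^ 2)}
      ≤ ENNReal.ofReal (2 * (1 / 2) ^ n) := by
  have h := hξ.measureQ_norm_radSum_lt_le S (fun k => a k / ρ) (by
    simp only [norm_div, Complex.norm_real, Real.norm_eq_abs, abs_of_pos hρ, div_pow]
    rw [← Finset.sum_div, one_le_div (by positivity)]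
    exact hnorm) hn
  refine (measure_mono fun q hq => ?_).trans h
  have hq' : radSum ξ S (fun k => a k / ρ) q = radSum ξ S a q / ρ := by
    simp only [radSum]
    rw [Finset.sum_div]
    exact Finset.sum_congr rfl fun k _ => by ring
  simp only [Set.mem_ofPred_eq] at hq ⊢
  rw [hq', norm_div, Complex.norm_real, Real.norm_eq_abs, abs_of_pos hρ, div_lt_iff₀ hρ]
  linarith

/-- If `f` is close to a function `b` of `ω` with small sup norm on a set of measure `ε`, then the
nonconstant part of `f` has variance of order at least `ε`. -/
theorem IsRademacherSeq.measureQ_norm_radSum_sub_lt_le_variance (hξ : IsRademacherSeq P ξ)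
    (S : Finset ℤ) (a : ℤ → ℂ) (hnorm : 9 / 10 ≤ ∑ k ∈ S, ‖a k‖ ^ 2) {b : Ω → ℂ}
    (hb : ∀ᵐ ω ∂P, ‖b ω‖ ≤ 1 / 20) (hη : ∑ k ∈ S.erase 0, ‖a k‖ ^ 2 ≤ 1 / 2) :
    measureQ P {q | ‖radSum ξ S a q - b q.1‖ < 1 / 20}
      ≤ ENNReal.ofReal (4 * ∑ k ∈ S.erase 0, ‖a k‖ ^ 2) := by
  have h0 : (0 : ℤ) ∈ S := by
    by_contra h
    rw [Finset.erase_eq_of_notMem h] at hη; linarith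
  have ha0 : 6 / 10 ≤ ‖a 0‖ := by
    have := Finset.add_sum_erase S (fun k => ‖a k‖ ^ 2) h0
    nlinarith [norm_nonneg (a 0)]
  have hb' : ∀ᵐ q ∂(measureQ P), ‖b q.1‖ ≤ 1 / 20 :=
    Measure.quasiMeasurePreserving_fst.ae hb
  have h := hξ.measureQ_le_norm_radSum_le (S.erase 0) a (s := 1 / 2) (by norm_num)
  refine (measure_mono_ae ?_).trans (h.trans (ENNReal.ofReal_le_ofReal (le_of_eq (by ring))))
  filter_upwards [hb'] with q hq hE
  change ‖radSum ξ S a q - b q.1‖ < 1 / 20 at hE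
  change 1 / 2 ≤ ‖radSum ξ (S.erase 0) a q‖
  have h1 : radSum ξ S a q = (ξ 0 q.1 : ℂ) * (a 0 * fourier 0 q.2) + radSum ξ (S.erase 0) a q :=
    (Finset.add_sum_erase S _ h0).symm
  have h2 : ‖(ξ 0 q.1 : ℂ) * (a 0 * fourier 0 q.2)‖ = ‖a 0‖ := by
    rw [hξ.norm_sign_mul]; simp
  have h3 : (ξ 0 q.1 : ℂ) * (a 0 * fourier 0 q.2)
      = (radSum ξ S a q - b q.1) + (b q.1 - radSum ξ (S.erase 0) a q) := by rw [h1]; ring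
  have h4 := norm_add_le (radSum ξ S a q - b q.1) (b q.1 - radSum ξ (S.erase 0) a q)
  have h5 := norm_sub_le (b q.1) (radSum ξ (S.erase 0) a q)
  rw [← h3, h2] at h4
  linarith

/-- Small ball estimate for finite Rademacher Fourier series around a function `b` of `ω`. The
difference of `f - b` along a translation of the circle does not depend on `b`. -/
theorem IsRademacherSeq.measureQ_norm_radSum_sub_lt_le (hξ : IsRademacherSeq P ξ)
    (S : Finset ℤ) (a : ℤ → ℂ) (hnorm : 9 / 10 ≤ ∑ k ∈ S, ‖a k‖ ^ 2) {b : Ω → ℂ}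
    (hbm : Measurable b) (hb : ∀ᵐ ω ∂P, ‖b ω‖ ≤ 1 / 20) {n : ℕ} (hn : 0 < n) :
    measureQ P {q | ‖radSum ξ S a q - b q.1‖ < (1 / 2) ^ (800 * n ^ 2)}
      ≤ ENNReal.ofReal ((1 / 2) ^ n) := by
  have hpow : ∀ {i j : ℕ}, i ≤ j → ((1 : ℝ) / 2) ^ j ≤ (1 / 2) ^ i := fun h =>
    pow_le_pow_of_le_one (by norm_num) (by norm_num) h
  have hnn : 1 ≤ n ^ 2 := Nat.one_le_pow _ _ hn
  set δ : ℝ := (1 / 2) ^ (800 * n ^ 2) with hδ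
  have hδ20 : δ ≤ 1 / 20 := (hpow (show 5 ≤ 800 * n ^ 2 by omega)).trans (by norm_num)
  set η := ∑ k ∈ S.erase 0, ‖a k‖ ^ 2 with hη
  rcases le_or_gt (4 * η) ((1 / 2) ^ n) with hsmall | hlarge
  · have h1 : η ≤ 1 / 2 := by
      have : ((1 : ℝ) / 2) ^ n ≤ 1 := pow_le_one₀ (by norm_num) (by norm_num)
      linarith
    exact (measure_mono (setOf_lt_subset_setOf_lt hδ20)).trans
      ((hξ.measureQ_norm_radSum_sub_lt_le_variance S a hnorm hb h1).trans
        (ENNReal.ofReal_le_ofReal hsmall))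
  have hη0 : 0 < η := by have : (0 : ℝ) < (1 / 2) ^ n := by positivity
                         linarith
  set E := {q : Ω × UnitAddCircle | ‖radSum ξ S a q - b q.1‖ < δ} with hEdef
  have hE : MeasurableSet E :=
    measurableSet_lt ((hξ.measurable_radSum S a).sub (hbm.comp measurable_fst)).norm
      measurable_const
  -- Squaring the measure of `E` doubles the exponent, and the bounds for the good and for the
  -- exceptional translations together cost a factor `4`.
  set m := 2 * n + 2 with hm
  set s : ℝ := (1 / 2) ^ (13 * m ^ 2) with hs
  set ρ : ℝ := (1 / 2) ^ (n + 2) * s with hρ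
  have hs0 : 0 < s := by positivity
  have hρ0 : 0 < ρ := by positivity
  have hρη : ρ ^ 2 ≤ η / 2 * s ^ 2 := by
    have h1 : ρ ^ 2 = ((1 / 2) ^ n / 16) * (1 / 2) ^ n * s ^ 2 := by rw [hρ]; ring
    rw [h1]
    refine mul_le_mul_of_nonneg_right ?_ (sq_nonneg s)
    have h2 : ((1 : ℝ) / 2) ^ n ≤ 1 := pow_le_one₀ (by norm_num) (by norm_num)
    have h3 : (0 : ℝ) < (1 / 2) ^ n := by positivity
    nlinarith
  have hδρ : 2 * δ ≤ ρ * (1 / 2) ^ (34 * m ^ 2) := by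
    have h1 : ρ * (1 / 2) ^ (34 * m ^ 2) = (1 / 2) ^ (n + 2 + 13 * m ^ 2 + 34 * m ^ 2) := by
      rw [hρ, hs, ← pow_add, ← pow_add]
    have h2 : 2 * ((1 : ℝ) / 2) ^ (n + 3 + 13 * m ^ 2 + 34 * m ^ 2)
        = (1 / 2) ^ (n + 2 + 13 * m ^ 2 + 34 * m ^ 2) := by
      rw [show n + 3 + 13 * m ^ 2 + 34 * m ^ 2 = (n + 2 + 13 * m ^ 2 + 34 * m ^ 2) + 1 by ring,
        pow_succ]
      ring
    rw [h1, ← h2]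
    refine mul_le_mul_of_nonneg_left (hpow ?_) two_pos.le
    rw [hm]; nlinarith
  set B := {t : UnitAddCircle | ∑ k ∈ S.erase 0, ‖a k‖ ^ 2 * ‖(fourier k t : ℂ) - 1‖ ^ 2
        < η / 2 * s ^ 2} with hB
  have hBvol : volume B ≤ ENNReal.ofReal (2 * (1 / 8) ^ m) :=
    volume_sum_mul_norm_fourier_sub_one_lt_le (Finset.notMem_erase 0 S) (fun k => sq_nonneg _)
      hη0 (by omega)
  have hF : MeasurableSet {x : (Ω × UnitAddCircle) × UnitAddCircle |
      x.1 ∈ E ∧ (x.1.1, x.1.2 + x.2) ∈ E} :=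
    (measurable_fst hE).inter ((by fun_prop : Measurable
      fun x : (Ω × UnitAddCircle) × UnitAddCircle => (x.1.1, x.1.2 + x.2)) hE)
  have hsq : measureQ P E ^ 2 ≤ ENNReal.ofReal (2 * (1 / 2) ^ m) + volume B := by
    refine (sq_measureQ_le hE).trans (measure_prod_le_add_of_forall_snd hF fun t ht => ?_)
    simp only [hB, Set.mem_ofPred_eq, not_lt] at ht
    refine (measure_mono fun q hq => ?_).trans (hξ.measureQ_norm_radSum_lt_le_of_sq_le (S.erase 0)
      (fun k => a k * ((fourier k t : ℂ) - 1)) hρ0 (hρη.trans ?_) (n := m) (by omega))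
    · obtain ⟨h1, h2⟩ := hq
      change ‖radSum ξ S a q - b q.1‖ < δ at h1
      change ‖radSum ξ S a (q.1, q.2 + t) - b q.1‖ < δ at h2
      change ‖radSum ξ (S.erase 0) _ (q.1, q.2)‖ < _
      rw [← radSum_add_sub]
      have h3 := norm_sub_le (radSum ξ S a (q.1, q.2 + t) - b q.1) (radSum ξ S a q - b q.1)
      rw [sub_sub_sub_cancel_right] at h3
      linarith
    · simpa only [norm_mul, mul_pow] using ht
  have hfin : ENNReal.ofReal (2 * (1 / 2) ^ m) + volume B ≤ ENNReal.ofReal ((1 / 2) ^ n) ^ 2 := by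
    refine (add_le_add_right hBvol _).trans ?_
    rw [← ENNReal.ofReal_add (by positivity) (by positivity),
      ← ENNReal.ofReal_pow (by positivity)]
    refine ENNReal.ofReal_le_ofReal ?_
    have h1 : ((1 : ℝ) / 8) ^ m ≤ (1 / 2) ^ m := pow_le_pow_left₀ (by norm_num) (by norm_num) m
    have h2 : ((1 : ℝ) / 2) ^ m = ((1 / 2) ^ n) ^ 2 / 4 := by rw [hm]; ring
    linarith
  exact (ENNReal.pow_le_pow_left_iff two_ne_zero).1 (hsq.trans hfin)

end Translation

/-! ### From small ball estimates to logarithmic moments -/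

theorem lintegral_ofReal_norm_sq {α : Type*} [MeasurableSpace α] {μ : Measure α}
    (h : Lp ℂ 2 μ) : ∫⁻ q, ENNReal.ofReal (‖h q‖ ^ 2) ∂μ = ENNReal.ofReal (‖h‖ ^ 2) := by
  have h1 := eLpNorm_nnreal_pow_eq_lintegral (f := h) (p := 2) (μ := μ) two_ne_zero
  have h2 : ENNReal.ofReal (‖h‖ ^ 2) = eLpNorm h 2 μ ^ 2 := by
    rw [ENNReal.ofReal_pow (norm_nonneg _), ofReal_norm, Lp.enorm_def]
  rw [h2]
  simp only [NNReal.coe_ofNat, ENNReal.coe_ofNat, ENNReal.rpow_ofNat] at h1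
  rw [h1]
  refine lintegral_congr fun q => ?_
  rw [ENNReal.ofReal_pow (norm_nonneg _), ofReal_norm]

section Closure

variable {Ω : Type*} [MeasurableSpace Ω] {P : Measure Ω} [IsProbabilityMeasure P]
  {ξ : ℤ → Ω → ℝ}

/-- Rademacher Fourier series are approximated in `L²` by finite ones. -/
theorem exists_radSum_of_mem_rademacherFourierSeries (hξ : IsRademacherSeq P ξ)
    {f : Lp ℂ 2 (measureQ P)} (hf : f ∈ rademacherFourierSeries hξ) {ε : ℝ} (hε : 0 < ε) :
    ∃ (S : Finset ℤ) (a : ℤ → ℂ) (g : Lp ℂ 2 (measureQ P)),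
      g =ᵐ[measureQ P] radSum ξ S a ∧ ∑ k ∈ S, ‖a k‖ ^ 2 = ‖g‖ ^ 2 ∧ ‖f - g‖ < ε := by
  obtain ⟨g, hg, hfg⟩ := Metric.mem_closure_iff.1
    (show f ∈ closure (Submodule.span ℂ (Set.range fun k : ℤ => (memLp_radChar hξ k).toLp) :
      Set (Lp ℂ 2 (measureQ P))) from hf) ε hε
  obtain ⟨c, hc⟩ := Finsupp.mem_span_range_iff_exists_finsupp.1 hg
  have hae : g =ᵐ[measureQ P] radSum ξ c.support c := by
    rw [← hc, Finsupp.sum]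
    have h1 : ∀ᵐ q ∂(measureQ P), ∀ k ∈ c.support,
        (c k • (memLp_radChar hξ k).toLp : Lp ℂ 2 (measureQ P)) q = c k * radChar ξ k q := by
      refine (ae_ball_iff c.support.countable_toSet).2 fun k _ => ?_
      filter_upwards [Lp.coeFn_smul (c k) (memLp_radChar hξ k).toLp,
        (memLp_radChar hξ k).coeFn_toLp] with q h2 h3
      rw [h2, Pi.smul_apply, h3, smul_eq_mul]
    filter_upwards [Lp.coeFn_finsetSum c.support
      fun k => (c k • (memLp_radChar hξ k).toLp : Lp ℂ 2 (measureQ P)), h1] with q h2 h3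
    rw [h2, Finset.sum_apply, radSum]
    refine Finset.sum_congr rfl fun k hk => ?_
    rw [h3 k hk, radChar]; ring
  refine ⟨c.support, c, g, hae, ?_, by rwa [← dist_eq_norm]⟩
  have h1 := hξ.lintegral_radSum_sq c.support c
  have h2 : ∫⁻ q, ENNReal.ofReal (‖radSum ξ c.support c q‖ ^ 2) ∂(measureQ P)
      = ENNReal.ofReal (‖g‖ ^ 2) := by
    rw [← lintegral_ofReal_norm_sq]
    refine lintegral_congr_ae ?_
    filter_upwards [hae] with q hq
    rw [hq]
  rw [h2] at h1
  exact ((ENNReal.ofReal_eq_ofReal_iff (sq_nonneg _)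
    (Finset.sum_nonneg fun k _ => sq_nonneg _)).1 h1).symm

/-- Small ball estimate for Rademacher Fourier series around a function `b` of `ω`. -/
theorem measureQ_norm_sub_lt_le (hξ : IsRademacherSeq P ξ)
    {f : Lp ℂ 2 (measureQ P)} (hf : f ∈ rademacherFourierSeries hξ) (hf1 : ‖f‖ = 1) {b : Ω → ℂ}
    (hbm : Measurable b) (hb : ∀ᵐ ω ∂P, ‖b ω‖ ≤ 1 / 20) (n : ℕ) :
    measureQ P {q | ‖f q - b q.1‖ < (1 / 2) ^ (801 * n ^ 2)}
      ≤ ENNReal.ofReal (2 * (1 / 2) ^ n) := by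
  rcases Nat.eq_zero_or_pos n with rfl | hn
  · exact prob_le_one.trans (by simp)
  set δ : ℝ := (1 / 2) ^ (801 * n ^ 2) with hδ
  have hδ0 : 0 < δ := by positivity
  have hδ2 : 2 * δ ≤ (1 / 2) ^ (800 * n ^ 2) := by
    have h1 : ((1 : ℝ) / 2) ^ (n ^ 2) ≤ 1 / 2 :=
      pow_le_of_le_one (by norm_num) (by norm_num) (by positivity)
    have h2 : δ = (1 / 2) ^ (800 * n ^ 2) * (1 / 2) ^ (n ^ 2) := by
      rw [hδ, ← pow_add]; congr 1; ring
    have h3 : (0 : ℝ) < (1 / 2) ^ (800 * n ^ 2) := by positivity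
    rw [h2]; nlinarith
  have hn0 : (0 : ℝ) < (1 / 2) ^ n := by positivity
  -- By Chebyshev's inequality, an `L²` error of `δ * (1 / 2) ^ n` exceeds `δ` with probability at
  -- most `(1 / 4) ^ n`; the bound `1 / 100` keeps the norm of the approximation close to `1`.
  obtain ⟨S, a, g, hg, hga, hfg⟩ := exists_radSum_of_mem_rademacherFourierSeries hξ hf
    (ε := min (1 / 100) (δ * (1 / 2) ^ n)) (by positivity)
  have hnorm : 9 / 10 ≤ ∑ k ∈ S, ‖a k‖ ^ 2 := by
    have h1 : ‖f - g‖ < 1 / 100 := hfg.trans_le (min_le_left _ _)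
    have h2 : ‖f‖ ≤ ‖f - g‖ + ‖g‖ := by simpa using norm_add_le (f - g) g
    rw [hga]; nlinarith
  have hfin := hξ.measureQ_norm_radSum_sub_lt_le S a hnorm hbm hb hn
  have hdiff : measureQ P {q | δ ^ 2 ≤ ‖(f - g : Lp ℂ 2 (measureQ P)) q‖ ^ 2}
      ≤ ENNReal.ofReal ((1 / 2) ^ n) := by
    have h1 := meas_ge_le_lintegral_div (μ := measureQ P)
      (f := fun q => ENNReal.ofReal (‖(f - g : Lp ℂ 2 (measureQ P)) q‖ ^ 2))
      (by have := (Lp.stronglyMeasurable (f - g)).measurable; fun_prop)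
      (ε := ENNReal.ofReal (δ ^ 2)) (ENNReal.ofReal_pos.2 (by positivity)).ne'
      ENNReal.ofReal_ne_top
    rw [lintegral_ofReal_norm_sq, ← ENNReal.ofReal_div_of_pos (by positivity)] at h1
    refine (measure_mono fun q hq => ENNReal.ofReal_le_ofReal hq).trans
      (h1.trans (ENNReal.ofReal_le_ofReal ?_))
    rw [div_le_iff₀ (by positivity)]
    have h2 : ‖f - g‖ ≤ δ * (1 / 2) ^ n := (hfg.trans_le (min_le_right _ _)).le
    have h3 : ‖f - g‖ ^ 2 ≤ (δ * (1 / 2) ^ n) ^ 2 := pow_le_pow_left₀ (norm_nonneg _) h2 2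
    have h4 : ((1 : ℝ) / 2) ^ n ≤ 1 := pow_le_one₀ (by norm_num) (by norm_num)
    have h5 : (δ * (1 / 2) ^ n) ^ 2 = (1 / 2) ^ n * (1 / 2) ^ n * δ ^ 2 := by ring
    have h6 : 0 < δ ^ 2 := by positivity
    rw [h5] at h3
    refine h3.trans (mul_le_mul_of_nonneg_right ?_ h6.le)
    exact mul_le_of_le_one_left hn0.le h4
  refine (measure_mono_ae (t := {q | ‖radSum ξ S a q - b q.1‖ < (1 / 2) ^ (800 * n ^ 2)} ∪
    {q | δ ^ 2 ≤ ‖(f - g : Lp ℂ 2 (measureQ P)) q‖ ^ 2}) ?_).trans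
    ((measure_union_le _ _).trans ((add_le_add hfin hdiff).trans (le_of_eq ?_)))
  · filter_upwards [hg, Lp.coeFn_sub f g] with q hq hsub hqf
    change ‖f q - b q.1‖ < δ at hqf
    by_contra hcon
    replace hcon : ¬ (‖radSum ξ S a q - b q.1‖ < (1 / 2) ^ (800 * n ^ 2) ∨
      δ ^ 2 ≤ ‖(f - g : Lp ℂ 2 (measureQ P)) q‖ ^ 2) := hcon
    rw [hsub, Pi.sub_apply, not_or, not_lt, not_le, hq] at hcon
    have h1 := lt_of_pow_lt_pow_left₀ 2 hδ0.le hcon.2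
    have h2 := norm_sub_le (f q - b q.1) (f q - radSum ξ S a q)
    rw [sub_sub_sub_cancel_left] at h2
    linarith [hcon.1]
  · rw [← ENNReal.ofReal_add (by positivity) (by positivity)]
    congr 1; ring

end Closure

/-- A majorant for powers of `|log ‖z‖|`. The series carries the part near `z = 0`: its terms
grow geometrically, while the small ball estimate makes their measures decay faster. -/
noncomputable def logMajorant (z : ℂ) : ℝ≥0∞ :=
  ENNReal.ofReal (‖z‖ ^ 2 + 1)
    + ∑' n : ℕ, {w : ℂ | ‖w‖ < (1 / 2) ^ (801 * n ^ 2)}.indicator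
        (fun _ => ENNReal.ofReal ((3 / 2) ^ n)) z

theorem logMajorant_zero : logMajorant 0 = ∞ := by
  have h : ∀ n : ℕ, {w : ℂ | ‖w‖ < (1 / 2) ^ (801 * n ^ 2)}.indicator
      (fun _ => ENNReal.ofReal ((3 / 2) ^ n)) (0 : ℂ) = ENNReal.ofReal ((3 / 2) ^ n) := fun n =>
    Set.indicator_of_mem (by simp) _
  rw [logMajorant, tsum_congr h, ENNReal.add_eq_top]
  refine Or.inr (top_le_iff.1 ?_)
  rw [← ENNReal.tsum_const_eq_top_of_ne_zero (α := ℕ) one_ne_zero]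
  refine ENNReal.tsum_le_tsum fun n => ?_
  rw [ENNReal.one_le_ofReal]
  exact one_le_pow₀ (by norm_num)

theorem abs_log_enorm {z : ℂ} (hz : z ≠ 0) :
    (ENNReal.log ‖z‖ₑ).abs = ENNReal.ofReal |Real.log ‖z‖| := by
  rw [← ofReal_norm, ENNReal.log_ofReal_of_pos (norm_pos_iff.2 hz), EReal.abs_def]

theorem log_rpow_le {x p : ℝ} (hx : 1 ≤ x) (hp : 1 ≤ p) :
    Real.log x ^ p ≤ p ^ p * (x ^ 2 + 1) := by
  have hp0 : 0 < p := by linarith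
  have h1 : Real.log x ≤ p * x ^ (1 / p) := by
    have h2 := Real.log_le_rpow_div (x := x) (by linarith) (show 0 < 1 / p by positivity)
    rwa [div_div_eq_mul_div, div_one, mul_comm] at h2
  calc Real.log x ^ p ≤ (p * x ^ (1 / p)) ^ p :=
        Real.rpow_le_rpow (Real.log_nonneg hx) h1 hp0.le
    _ = p ^ p * x := by
        rw [Real.mul_rpow hp0.le (by positivity), ← Real.rpow_mul (by linarith),
          one_div_mul_cancel hp0.ne', Real.rpow_one]
    _ ≤ _ := by
        refine mul_le_mul_of_nonneg_left ?_ (by positivity)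
        nlinarith

theorem mul_sq_rpow_le {p : ℝ} (hp : 1 ≤ p) (n : ℕ) :
    (801 * ((n : ℝ) + 1) ^ 2) ^ p ≤ (51264 * p ^ 2) ^ p * (3 / 2) * (3 / 2) ^ n := by
  have hp0 : 0 < p := by linarith
  set y : ℝ := ((n : ℝ) + 1) / (8 * p) with hy
  have hy0 : 0 ≤ y := by positivity
  have h1 : 801 * ((n : ℝ) + 1) ^ 2 = 51264 * p ^ 2 * y ^ 2 := by
    rw [hy]; field_simp; norm_num
  have h2 : y ≤ Real.exp y := by linarith [Real.add_one_le_exp y]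
  have h3 : (y ^ 2) ^ p ≤ Real.exp ((n + 1 : ℕ) * (1 / 4)) := by
    calc (y ^ 2) ^ p ≤ (Real.exp y ^ 2) ^ p :=
          Real.rpow_le_rpow (by positivity) (pow_le_pow_left₀ hy0 h2 2) hp0.le
      _ = Real.exp ((n + 1 : ℕ) * (1 / 4)) := by
          rw [← Real.exp_nat_mul, ← Real.exp_mul, hy]
          congr 1
          push_cast
          field_simp
          norm_num
  have h4 : Real.exp (1 / 4) ≤ 3 / 2 := by
    have := Real.exp_bound_div_one_sub_of_interval (x := 1 / 4) (by norm_num) (by norm_num)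
    exact this.trans (by norm_num)
  rw [Real.exp_nat_mul] at h3
  rw [h1, Real.mul_rpow (by positivity) (by positivity), mul_assoc]
  refine mul_le_mul_of_nonneg_left (h3.trans ?_) (by positivity)
  rw [← pow_succ']
  exact pow_le_pow_left₀ (Real.exp_pos _).le h4 _

theorem abs_log_enorm_rpow_le (z : ℂ) {p : ℝ} (hp : 1 ≤ p) :
    (ENNReal.log ‖z‖ₑ).abs ^ p
      ≤ ENNReal.ofReal ((51264 * p ^ 2) ^ p * (3 / 2)) * logMajorant z := by
  have hp0 : 0 < p := by linarith
  have hM : 0 < (51264 * p ^ 2) ^ p * (3 / 2) := by positivity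
  rcases eq_or_ne z 0 with rfl | hz
  · rw [logMajorant_zero, ENNReal.mul_top (ENNReal.ofReal_pos.2 hM).ne']
    exact le_top
  have hx : 0 < ‖z‖ := norm_pos_iff.2 hz
  rw [abs_log_enorm hz, ENNReal.ofReal_rpow_of_nonneg (abs_nonneg _) hp0.le, logMajorant]
  rcases le_or_gt 1 ‖z‖ with h1 | h1
  · refine le_trans ?_ (mul_le_mul_right le_self_add _)
    rw [← ENNReal.ofReal_mul hM.le, abs_of_nonneg (Real.log_nonneg h1)]
    refine ENNReal.ofReal_le_ofReal ((log_rpow_le h1 hp).trans ?_)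
    refine mul_le_mul_of_nonneg_right ?_ (by positivity)
    have h2 : p ^ p ≤ (51264 * p ^ 2) ^ p := Real.rpow_le_rpow hp0.le (by nlinarith) hp0.le
    have h3 : 0 < (51264 * p ^ 2) ^ p := by positivity
    linarith
  · -- The scale `n` for which `‖z‖` lies between two consecutive thresholds.
    have hex : ∃ n : ℕ, ((1 : ℝ) / 2) ^ (801 * n ^ 2) ≤ ‖z‖ := by
      obtain ⟨n, hn⟩ := exists_pow_lt_of_lt_one hx (show (1 : ℝ) / 2 < 1 by norm_num)
      refine ⟨n, le_trans (pow_le_pow_of_le_one (by norm_num) (by norm_num) ?_) hn.le⟩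
      have := Nat.le_self_pow two_ne_zero n; omega
    classical
    obtain ⟨n, hn, hn'⟩ : ∃ n : ℕ, ‖z‖ < (1 / 2) ^ (801 * n ^ 2) ∧
        ((1 : ℝ) / 2) ^ (801 * (n + 1) ^ 2) ≤ ‖z‖ := by
      have h0 : Nat.find hex ≠ 0 := fun h => by
        have h2 := Nat.find_spec hex
        rw [h] at h2
        norm_num at h2
        linarith
      obtain ⟨n, hn⟩ := Nat.exists_eq_succ_of_ne_zero h0
      refine ⟨n, not_le.1 (Nat.find_min hex (by omega)), ?_⟩
      have h2 := Nat.find_spec hex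
      rwa [hn] at h2
    refine le_trans ?_ (mul_le_mul_right ((ENNReal.le_tsum n).trans le_add_self) _)
    rw [Set.indicator_of_mem (by exact hn), ← ENNReal.ofReal_mul hM.le]
    refine ENNReal.ofReal_le_ofReal (le_trans ?_ (mul_sq_rpow_le hp n))
    refine Real.rpow_le_rpow (abs_nonneg _) ?_ hp0.le
    rw [abs_of_neg (Real.log_neg hx h1)]
    have h2 := Real.log_le_log (by positivity) hn'
    rw [Real.log_pow, one_div, Real.log_inv] at h2
    have h3 := Real.log_two_lt_d9
    push_cast at h2
    nlinarith [sq_nonneg ((n : ℝ) + 1)]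

section Moments

variable {Ω : Type*} [MeasurableSpace Ω] {P : Measure Ω} [IsProbabilityMeasure P]
  {ξ : ℤ → Ω → ℝ}

theorem lintegral_logMajorant_sub_le (hξ : IsRademacherSeq P ξ)
    {f : Lp ℂ 2 (measureQ P)} (hf : f ∈ rademacherFourierSeries hξ) (hf1 : ‖f‖ = 1) {b : Ω → ℂ}
    (hbm : Measurable b) (hb : ∀ᵐ ω ∂P, ‖b ω‖ ≤ 1 / 20) :
    ∫⁻ q, logMajorant (f q - b q.1) ∂(measureQ P) ≤ 12 := by
  have hfm : Measurable f := (Lp.stronglyMeasurable f).measurable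
  have hm : Measurable fun q => f q - b q.1 := hfm.sub (hbm.comp measurable_fst)
  have hb' : ∀ᵐ q ∂(measureQ P), ‖b q.1‖ ≤ 1 / 20 := Measure.quasiMeasurePreserving_fst.ae hb
  have hsm : ∀ n : ℕ, MeasurableSet {q | ‖f q - b q.1‖ < (1 / 2) ^ (801 * n ^ 2)} := fun n =>
    measurableSet_lt hm.norm measurable_const
  have hind : ∀ (n : ℕ) q, {w : ℂ | ‖w‖ < (1 / 2) ^ (801 * n ^ 2)}.indicator
      (fun _ => ENNReal.ofReal ((3 / 2) ^ n)) (f q - b q.1)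
      = {q | ‖f q - b q.1‖ < (1 / 2) ^ (801 * n ^ 2)}.indicator
        (fun _ => ENNReal.ofReal ((3 / 2) ^ n)) q := fun n q => rfl
  have h1 : ∫⁻ q, ENNReal.ofReal (‖f q - b q.1‖ ^ 2 + 1) ∂(measureQ P) ≤ 4 := by
    calc _ ≤ ∫⁻ q, (2 * ENNReal.ofReal (‖f q‖ ^ 2) + 2) ∂(measureQ P) := by
          refine lintegral_mono_ae ?_
          filter_upwards [hb'] with q hq
          have h2 : (2 : ℝ≥0∞) * ENNReal.ofReal (‖f q‖ ^ 2) + 2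
              = ENNReal.ofReal (2 * ‖f q‖ ^ 2 + 2) := by
            rw [ENNReal.ofReal_add (by positivity) two_pos.le, ENNReal.ofReal_mul two_pos.le]
            simp
          rw [h2]
          refine ENNReal.ofReal_le_ofReal ?_
          have h3 := norm_sub_le (f q) (b q.1)
          have h4 : ‖f q - b q.1‖ ^ 2 ≤ (‖f q‖ + 1 / 20) ^ 2 :=
            pow_le_pow_left₀ (norm_nonneg _) (by linarith) 2
          nlinarith [sq_nonneg (‖f q‖ - 1 / 20)]
      _ = 4 := by
          rw [lintegral_add_right _ measurable_const, lintegral_const_mul _ (by fun_prop),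
            lintegral_ofReal_norm_sq, hf1]
          simp; norm_num
  have h2 : ∫⁻ q, ∑' n : ℕ, {w : ℂ | ‖w‖ < (1 / 2) ^ (801 * n ^ 2)}.indicator
      (fun _ => ENNReal.ofReal ((3 / 2) ^ n)) (f q - b q.1) ∂(measureQ P) ≤ 8 := by
    simp only [hind]
    rw [lintegral_tsum fun n => (measurable_const.indicator (hsm n)).aemeasurable]
    calc _ ≤ ∑' n : ℕ, ENNReal.ofReal (2 * (3 / 4) ^ n) := by
          refine ENNReal.tsum_le_tsum fun n => ?_
          rw [lintegral_indicator_const (hsm n)]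
          refine (mul_le_mul_right (measureQ_norm_sub_lt_le hξ hf hf1 hbm hb n) _).trans ?_
          rw [← ENNReal.ofReal_mul (by positivity)]
          refine ENNReal.ofReal_le_ofReal (le_of_eq ?_)
          rw [mul_left_comm, ← mul_pow]; norm_num
      _ = 8 := by
          have hs : HasSum (fun n : ℕ => 2 * ((3 : ℝ) / 4) ^ n) 8 := by
            have := (hasSum_geometric_of_lt_one (r := (3 : ℝ) / 4) (by norm_num)
              (by norm_num)).mul_left 2
            norm_num at this ⊢
            exact this
          rw [← ENNReal.ofReal_tsum_of_nonneg (fun n => by positivity) hs.summable, hs.tsum_eq]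
          simp
  simp only [logMajorant]
  rw [lintegral_add_left (by fun_prop)]
  calc _ ≤ (4 : ℝ≥0∞) + 8 := add_le_add h1 h2
    _ = 12 := by norm_num

theorem lintegral_abs_log_rpow_le (hξ : IsRademacherSeq P ξ)
    {f : Lp ℂ 2 (measureQ P)} (hf : f ∈ rademacherFourierSeries hξ) (hf1 : ‖f‖ = 1) {b : Ω → ℂ}
    (hbm : Measurable b) (hb : ∀ᵐ ω ∂P, ‖b ω‖ ≤ 1 / 20) {p : ℝ} (hp : 1 ≤ p) :
    ∫⁻ q, (ENNReal.log ‖f q - b q.1‖ₑ).abs ^ p ∂(measureQ P)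
      ≤ ENNReal.ofReal ((10 * p) ^ (6 * p)) := by
  have hp0 : 0 < p := by linarith
  calc _ ≤ ∫⁻ q, ENNReal.ofReal ((51264 * p ^ 2) ^ p * (3 / 2)) * logMajorant (f q - b q.1)
        ∂(measureQ P) := lintegral_mono fun q => abs_log_enorm_rpow_le _ hp
    _ ≤ ENNReal.ofReal ((51264 * p ^ 2) ^ p * (3 / 2)) * 12 := by
        rw [lintegral_const_mul' _ _ ENNReal.ofReal_ne_top]
        gcongr
        exact lintegral_logMajorant_sub_le hξ hf hf1 hbm hb
    _ = ENNReal.ofReal (18 * (51264 * p ^ 2) ^ p) := by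
        rw [show (12 : ℝ≥0∞) = ENNReal.ofReal 12 by simp, ← ENNReal.ofReal_mul (by positivity)]
        congr 1; ring
    _ ≤ _ := by
        refine ENNReal.ofReal_le_ofReal ?_
        have h1 : (18 : ℝ) ≤ 18 ^ p := Real.self_le_rpow_of_one_le (by norm_num) hp
        have h2 : (10 * p) ^ (6 * p) = ((10 * p) ^ 6) ^ p := by
          rw [Real.rpow_mul (by positivity)]; norm_cast
        have h3 : p ^ 2 ≤ p ^ 6 := pow_le_pow_right₀ hp (by norm_num)
        calc 18 * (51264 * p ^ 2) ^ p ≤ 18 ^ p * (51264 * p ^ 2) ^ p :=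
              mul_le_mul_of_nonneg_right h1 (by positivity)
          _ = (18 * (51264 * p ^ 2)) ^ p := (Real.mul_rpow (by norm_num) (by positivity)).symm
          _ ≤ _ := by
              rw [h2]
              refine Real.rpow_le_rpow (by positivity) ?_ hp0.le
              rw [mul_pow]; nlinarith

theorem ae_ne_zero_of_mem_rademacherFourierSeries (hξ : IsRademacherSeq P ξ)
    {f : Lp ℂ 2 (measureQ P)} (hf : f ∈ rademacherFourierSeries hξ) (hf1 : ‖f‖ = 1) :
    ∀ᵐ q ∂(measureQ P), f q ≠ 0 := by
  rw [ae_iff]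
  simp only [ne_eq, not_not]
  refine le_antisymm (ge_of_tendsto' (x := Filter.atTop) (f := fun n : ℕ =>
    ENNReal.ofReal (2 * (1 / 2) ^ n)) ?_ fun n => ?_) zero_le
  · have h := (tendsto_pow_atTop_nhds_zero_of_lt_one (r := (1 : ℝ) / 2) (by norm_num)
      (by norm_num)).const_mul 2
    simpa using ENNReal.tendsto_ofReal h
  · refine (measure_mono fun q hq => ?_).trans (measureQ_norm_sub_lt_le hξ hf hf1
      (b := fun _ => 0) measurable_const (Filter.Eventually.of_forall fun _ => by simp) n)
    have hq' : f q = 0 := hq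
    simp [hq']

theorem integrable_abs_log_rpow (hξ : IsRademacherSeq P ξ)
    {f : Lp ℂ 2 (measureQ P)} (hf : f ∈ rademacherFourierSeries hξ) (hf1 : ‖f‖ = 1) {p : ℝ}
    (hp : 0 < p) : Integrable (fun q => |Real.log ‖f q‖| ^ p) (measureQ P) := by
  have hfm : Measurable f := (Lp.stronglyMeasurable f).measurable
  have hm : ∀ s : ℝ, Measurable fun q => |Real.log ‖f q‖| ^ s := fun s => by fun_prop
  have hmain : ∀ s : ℝ, 1 ≤ s → Integrable (fun q => |Real.log ‖f q‖| ^ s) (measureQ P) := by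
    intro s hs
    refine ⟨(hm s).aestronglyMeasurable, ?_⟩
    have h := lintegral_abs_log_rpow_le hξ hf hf1 (b := fun _ => 0) measurable_const
      (Filter.Eventually.of_forall fun _ => by simp) hs
    refine lt_of_le_of_lt ((lintegral_mono_ae ?_).trans h) ENNReal.ofReal_lt_top
    filter_upwards [ae_ne_zero_of_mem_rademacherFourierSeries hξ hf hf1] with q hq
    rw [sub_zero, abs_log_enorm hq, ENNReal.ofReal_rpow_of_nonneg (abs_nonneg _) (by linarith),
      Real.enorm_of_nonneg (by positivity)]
  refine ((integrable_const (1 : ℝ)).add (hmain (p + 1) (by linarith))).mono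
    (hm p).aestronglyMeasurable (Filter.Eventually.of_forall fun q => ?_)
  have h0 := abs_nonneg (Real.log ‖f q‖)
  have h1 : 0 ≤ |Real.log ‖f q‖| ^ p := by positivity
  have h2 : 0 ≤ |Real.log ‖f q‖| ^ (p + 1) := by positivity
  rw [Real.norm_of_nonneg h1, Pi.add_apply, Real.norm_of_nonneg (by positivity)]
  rcases le_total |Real.log ‖f q‖| 1 with h | h
  · linarith [Real.rpow_le_one h0 h hp.le]
  · linarith [Real.rpow_le_rpow_of_exponent_le h (show p ≤ p + 1 by linarith)]

end Moments

/-- `(ENNReal.log ‖z‖ₑ).abs` is `|log |z||` as an element of `[0, ∞]`, with value `∞` at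
`z = 0`. -/
theorem corollary2p2 :
    ∃ C : ℝ, 0 < C ∧
      ∀ (Ω : Type*) [MeasurableSpace Ω] (P : Measure Ω) [IsProbabilityMeasure P]
        (ξ : ℤ → Ω → ℝ) (hξ : IsRademacherSeq P ξ) (f : Lp ℂ 2 (measureQ P)),
        f ∈ rademacherFourierSeries hξ → ‖f‖ = 1 →
        (∀ b : Lp ℂ ∞ P, ‖b‖ < 1 / 20 → ∀ p : ℝ, 1 ≤ p →
          ∫⁻ q, (ENNReal.log ‖f q - b q.1‖ₑ).abs ^ p ∂(measureQ P)
            ≤ ENNReal.ofReal ((C * p) ^ (6 * p))) ∧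
        (∀ᵐ q ∂(measureQ P), f q ≠ 0) ∧
        (∀ p : ℝ, 0 < p → Integrable (fun q => |Real.log ‖f q‖| ^ p) (measureQ P)) ∧
        (∀ n : ℕ, Integrable (fun q => Real.log ‖f q‖ ^ n) (measureQ P)) := by
  refine ⟨10, by norm_num, fun Ω _ P _ ξ hξ f hf hf1 => ⟨fun b hb p hp => ?_,
    ae_ne_zero_of_mem_rademacherFourierSeries hξ hf hf1,
    fun p hp => integrable_abs_log_rpow hξ hf hf1 hp, fun n => ?_⟩⟩
  · refine lintegral_abs_log_rpow_le hξ hf hf1 (Lp.stronglyMeasurable b).measurable ?_ hp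
    have h : ∀ᵐ ω ∂P, ‖b ω‖ₑ ≤ ‖b‖ₑ := by
      rw [Lp.enorm_def, eLpNorm_exponent_top]
      exact ae_le_eLpNormEssSup
    filter_upwards [h] with ω hω
    rw [enorm_le_iff_norm_le] at hω
    exact hω.trans hb.le
  · rcases Nat.eq_zero_or_pos n with rfl | hn
    · simp
    have hfm : Measurable f := (Lp.stronglyMeasurable f).measurable
    refine (integrable_abs_log_rpow hξ hf hf1 (p := n) (by exact_mod_cast hn)).mono
      (Measurable.aestronglyMeasurable (by fun_prop)) (Filter.Eventually.of_forall fun q => ?_)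
    rw [Real.rpow_natCast]
    simp
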